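/- Let $N\in\mathbb{N}$, let $a_1,\dots,a_N,w_1,\dots,w_N\in\mathbb{C}$ and $$g(t)=\sum_{k=1}^N\frac{a_k}{t-iw_k},\qquad t\in\mathbb{R}.$$ Assume that $\operatorname{Re}w_k<0$ for $k=1,\dots,N$, that $\operatorname{Re}w_j\neq\operatorname{Re}w_k$ for $j\neq k$, and that $\hat g(\xi)\neq0$ for every $\xi>0$, where $$\hat g(\xi)=\int_{-\infty}^{\infty}g(t)e^{-2\pi it\xi}\,dt:=\lim_{R\to\infty}\int_{-R}^{R}g(t)e^{-2\pi it\xi}\,dt$$ (under the assumption on the $w_k$ this limit exists for every $\xi>0$). Then for all $\alpha,\beta>0$ with $\alpha\beta<1$ and $\alpha\beta\notin\mathbb{Q}$ the Gabor system $$\mathcal{G}(g;\alpha,\beta)=\{e^{2\pi i\beta nt}g(t-\alpha m)\}_{m,n\in\mathbb{Z}}\subset L^2(\mathbb{R})$$ is a frame in $L^2(\mathbb{R})$, i.e. there are constants $A>0$ and $B<\infty$ such that $$A\|f\|^2\le\sum_{m,n\in\mathbb{Z}}\Bigl|\int_{-\infty}^{\infty}f(t)\,\overline{e^{2\pi i\beta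 nt}g(t-\alpha m)}\,dt\Bigr|^2\le B\|f\|^2\qquad\text{for all }f\in L^2(\mathbb{R}).$$ -/

import Mathlib

open MeasureTheory Filter Topology

noncomputable section

/-- The rational window `g(t) = ∑ₖ aₖ / (t - i wₖ)`. -/
def rationalWindow {N : ℕ} (a w : Fin N → ℂ) (t : ℝ) : ℂ :=
  ∑ k, a k / ((t : ℂ) - Complex.I * w k)

/-- The Fourier transform `ĝ(ξ) = ∫_{-∞}^{∞} g(t) e^{-2π i t ξ} dt`, the integral being understood
as the improper integral `lim_{R → ∞} ∫_{-R}^{R}`. The windows considered here decay in general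
only like `1 / |t|`, so that the integral need not converge absolutely. For windows as above with
poles off the real line the limit exists for every `ξ ≠ 0`. -/
def fourierImproper (g : ℝ → ℂ) (ξ : ℝ) : ℂ :=
  limUnder atTop fun R : ℝ =>
    ∫ t in (-R)..R, g t * Complex.exp (-(2 * Real.pi * Complex.I * t * ξ))

/-- The time-frequency shift `π_{x,y} g(t) = e^{2π i y t} g(t - x)`. -/
def timeFreqShift (x y : ℝ) (g : ℝ → ℂ) (t : ℝ) : ℂ :=
  Complex.exp (2 * Real.pi * Complex.I * y * t) * g (t - x)

/-- The Gabor system `(π_{α m, β n} g)`, indexed by `(m, n) ∈ ℤ × ℤ`. -/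
def gaborSystem (g : ℝ → ℂ) (α β : ℝ) (p : ℤ × ℤ) : ℝ → ℂ :=
  timeFreqShift (α * p.1) (β * p.2) g

/-- A family of vectors of a complex inner product space is a frame if it satisfies the two-sided
frame inequality with some constants `0 < A` and `B < ∞`. -/
def IsFrame {ι H : Type*} [NormedAddCommGroup H] [InnerProductSpace ℂ H] (φ : ι → H) : Prop :=
  ∃ A B : ℝ, 0 < A ∧ ∀ f : H,
    Summable (fun i => ‖inner ℂ f (φ i)‖ ^ 2) ∧
      A * ‖f‖ ^ 2 ≤ ∑' i, ‖inner ℂ f (φ i)‖ ^ 2 ∧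
      ∑' i, ‖inner ℂ f (φ i)‖ ^ 2 ≤ B * ‖f‖ ^ 2

/-- The Gabor system of `g` consists of square integrable functions and is a frame in `L²(ℝ)`. -/
def IsGaborFrame (g : ℝ → ℂ) (α β : ℝ) : Prop :=
  ∃ h : ∀ p : ℤ × ℤ, MemLp (gaborSystem g α β p) 2 (volume : Measure ℝ),
    IsFrame (H := Lp ℂ 2 (volume : Measure ℝ)) fun p => (h p).toLp (gaborSystem g α β p)

end

open FourierTransform ComplexConjugate

/-! ### Exponential sums -/

section ExponentialSums

variable {ι : Type*} [Fintype ι]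

/-! On the Fourier side the window is a causal exponential sum `H = causalExpSum b z`, which does
not vanish on the positive half-line. Put `T = 1 / α > β`. Plancherel, followed by Parseval for
`T`-periodizations, reduces the frame inequality to a statement about sequences: uniformly in `η`,
the `ℓ²` norm of `c` is comparable to that of the samples `∑ⱼ cⱼ H(β m - (η + T j))`, which are
`nodeSamples`. The upper bound is a Schur test (`exists_tsum_nodeSamples_le`).

For the lower bound, all that the nodes before the `j`-th contribute to later samples is encoded in
the finite vector `pastState`. As `β < T`, some sample lies between two successive nodes, at
distance at least `T - β` from the earlier one. Since `H` has no zeros, that sample and the state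
determine `cⱼ`, hence the next state, with bounded loss (`exists_coeff_step_bound`). It remains to
read off the state from finitely many samples at some node boundedly far back.

For a node at offset `θ` from a sample point this is left invertibility of `phaseMatrix`. After
rescaling, the matrix converges as `θ → -∞` to one in which only the dominant exponential of `H`
survives at the nodes, and that limit is injective (`exists_injective_phaseMatrixLimit`). By
analyticity in `θ` there are good phases in every `(0, ε)`, and by continuity whole intervals of
them. Irrationality of `β / T` makes a bounded number of backward steps reach such an interval
(`exists_bounded_return`). `exists_coeff_bound` assembles these facts. -/

theorem eq_zero_of_frequently_sum_mul_pow_eq_zero {μ γ : ι → ℂ}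
    (hμ : Function.Injective fun k => ‖μ k‖) (hμ0 : ∀ k, μ k ≠ 0)
    (h : ∃ᶠ m : ℕ in atTop, ∑ k, γ k * μ k ^ m = 0) : γ = 0 := by
  classical
  by_contra hγ
  obtain ⟨k₁, hk₁⟩ : ∃ k, γ k ≠ 0 := by
    by_contra! hc
    exact hγ (funext hc)
  -- Divided by `μ k₀ ^ m`, with `μ k₀` of largest modulus among the terms present, the sum tends to
  -- `γ k₀ ≠ 0`.
  obtain ⟨k₀, hk₀, hmax⟩ := (Finset.univ.filter fun k => γ k ≠ 0).exists_max_image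
    (fun k => ‖μ k‖) ⟨k₁, by simpa using hk₁⟩
  have hk₀' : γ k₀ ≠ 0 := by simpa using hk₀
  have hlim : Tendsto (fun m : ℕ => ∑ k, γ k * (μ k / μ k₀) ^ m) atTop
      (𝓝 (∑ k, if k = k₀ then γ k₀ else 0)) := by
    refine tendsto_finsetSum _ fun k _ => ?_
    split_ifs with hk
    · subst hk
      simp [div_self (hμ0 k)]
    · by_cases hγk : γ k = 0
      · simp [hγk]
      · have hle := hmax k (by simpa using hγk)
        have hlt : ‖μ k‖ < ‖μ k₀‖ := lt_of_le_of_ne hle fun he => hk (hμ he)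
        have : Tendsto (fun m : ℕ => (μ k / μ k₀) ^ m) atTop (𝓝 0) := by
          apply tendsto_pow_atTop_nhds_zero_of_norm_lt_one
          rw [norm_div, div_lt_one (norm_pos_iff.2 (hμ0 k₀))]
          exact hlt
        simpa using this.const_mul (γ k)
  rw [Finset.sum_ite_eq' Finset.univ k₀] at hlim
  simp only [Finset.mem_univ, if_true] at hlim
  have hne := hlim.eventually_ne hk₀'
  obtain ⟨m, hm, hm'⟩ := (h.and_eventually hne).exists
  apply hm'
  have : ∑ k, γ k * (μ k / μ k₀) ^ m = (∑ k, γ k * μ k ^ m) / μ k₀ ^ m := by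
    rw [Finset.sum_div]
    exact Finset.sum_congr rfl fun k _ => by rw [div_pow, mul_div_assoc]
  rw [this, hm, zero_div]

/-- The solution spaces decrease with `L` inside a finite-dimensional space, so they become
stationary; the stationary space satisfies all conditions from `E` and is zero. -/
theorem exists_forall_sum_mul_pow_eq_zero {μ : ι → ℂ}
    (hμ : Function.Injective fun k => ‖μ k‖) (hμ0 : ∀ k, μ k ≠ 0) {E : Set ℕ}
    (hE : ∃ᶠ m in atTop, m ∈ E) :
    ∃ L : ℕ, ∀ γ : ι → ℂ, (∀ m ∈ E, m < L → ∑ k, γ k * μ k ^ m = 0) → γ = 0 := by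
  let V : ℕ →o (Submodule ℂ (ι → ℂ))ᵒᵈ :=
    { toFun := fun L => OrderDual.toDual
        { carrier := {γ | ∀ m ∈ E, m < L → ∑ k, γ k * μ k ^ m = 0}
          add_mem' := by
            intro γ γ' h h' m hm hL
            simp [add_mul, Finset.sum_add_distrib, h m hm hL, h' m hm hL]
          zero_mem' := by
            intro m _ _
            simp
          smul_mem' := by
            intro c γ h m hm hL
            simp [mul_assoc, ← Finset.mul_sum, h m hm hL] }
      monotone' := by
        intro L L' hL
        rw [OrderDual.toDual_le_toDual]
        intro γ h m hm hmL
        exact h m hm (hmL.trans_le hL) }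
  obtain ⟨L, hL⟩ := monotone_stabilizes_iff_artinian.2 (inferInstance : IsArtinian ℂ (ι → ℂ)) V
  refine ⟨L, fun γ hγ => eq_zero_of_frequently_sum_mul_pow_eq_zero hμ hμ0 (hE.mono ?_)⟩
  intro m hm
  have h1 : γ ∈ OrderDual.ofDual (V L) := hγ
  have h2 : γ ∈ OrderDual.ofDual (V (max L (m + 1))) := by
    rw [← hL _ (le_max_left _ _)]
    exact h1
  exact h2 m hm (lt_of_lt_of_le (Nat.lt_succ_self m) (le_max_right _ _))

/-- The exponential sum `∑ₖ aₖ exp (zₖ τ)`. -/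
noncomputable def expSum (a z : ι → ℂ) (τ : ℝ) : ℂ :=
  ∑ k, a k * Complex.exp (z k * τ)

theorem continuous_expSum (a z : ι → ℂ) : Continuous (expSum a z) := by
  unfold expSum
  fun_prop

theorem exists_dominant {a z : ι → ℂ} (hz : Function.Injective fun k => (z k).re)
    (ha : ∃ k, a k ≠ 0) :
    ∃ k₁, a k₁ ≠ 0 ∧ ∀ k, k ≠ k₁ → a k ≠ 0 → (z k).re < (z k₁).re := by
  classical
  obtain ⟨k₀, hk₀⟩ := ha
  obtain ⟨k₁, hk₁, hmax⟩ := (Finset.univ.filter fun k => a k ≠ 0).exists_max_image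
    (fun k => (z k).re) ⟨k₀, by simpa using hk₀⟩
  refine ⟨k₁, by simpa using hk₁, fun k hk hak => lt_of_le_of_ne (hmax k (by simpa using hak)) ?_⟩
  exact fun he => hk (hz he)

/-- The factor `exp (z k₁ * θ)` compensates the dominant term exactly; every other term keeps `exp
((z k₁ - z k) * θ)`, which decays as `θ → -∞`. -/
theorem tendsto_expSum_mul_exp_atBot {a z : ι → ℂ} {k₁ : ι}
    (hk : ∀ k, k ≠ k₁ → a k ≠ 0 → (z k).re < (z k₁).re) (x : ℝ) :
    Tendsto (fun θ : ℝ => expSum a z (x - θ) * Complex.exp (z k₁ * θ)) atBot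
      (𝓝 (a k₁ * Complex.exp (z k₁ * x))) := by
  classical
  have hlim : Tendsto (fun θ : ℝ => ∑ k, a k * Complex.exp (z k * x) *
      Complex.exp ((z k₁ - z k) * θ)) atBot
      (𝓝 (∑ k, if k = k₁ then a k₁ * Complex.exp (z k₁ * x) else 0)) := by
    refine tendsto_finsetSum _ fun k _ => ?_
    split_ifs with h
    · subst h
      simp
    · by_cases hak : a k = 0
      · simp [hak]
      · have h0 : Tendsto (fun θ : ℝ => Complex.exp ((z k₁ - z k) * θ)) atBot (𝓝 0) := by
          rw [tendsto_zero_iff_norm_tendsto_zero]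
          simp only [Complex.norm_exp]
          have hpos : 0 < (z k₁).re - (z k).re := sub_pos.2 (hk k h hak)
          have : ∀ θ : ℝ, ((z k₁ - z k) * θ).re = ((z k₁).re - (z k).re) * θ := by
            intro θ; simp
          simp only [this]
          exact Real.tendsto_exp_atBot.comp (tendsto_id.const_mul_atBot hpos)
        simpa using h0.const_mul (a k * Complex.exp (z k * x))
  rw [Finset.sum_ite_eq' Finset.univ k₁] at hlim
  simp only [Finset.mem_univ, if_true] at hlim
  refine hlim.congr fun θ => ?_
  rw [expSum, Finset.sum_mul]
  refine Finset.sum_congr rfl fun k _ => ?_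
  rw [mul_assoc, mul_assoc, ← Complex.exp_add, ← Complex.exp_add]
  congr 2
  push_cast
  ring

end ExponentialSums

/-! ### The phase matrices -/

section PhaseMatrix

/-- If every late interval between samples contained a node, these nodes would be distinct, so the
nodes would be at least as dense as the samples, against `β < T`. -/
theorem frequently_gap {β T : ℝ} (hβ : 0 < β) (hβT : β < T) :
    ∃ᶠ m : ℕ in atTop, ∀ i : ℕ, ¬ (β * m ≤ T * i ∧ T * i < β * (m + 1)) := by
  have hT : 0 < T := hβ.trans hβT
  intro hc
  simp only [not_not, not_forall] at hc
  obtain ⟨M, hM⟩ := eventually_atTop.1 hc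
  have hchain : ∀ k : ℕ, ∃ i : ℕ, (k ≤ i) ∧ T * i < β * ((M + k : ℕ) + 1) ∧
      β * (M + k : ℕ) ≤ T * i := by
    intro k
    induction k with
    | zero =>
      obtain ⟨i, h1, h2⟩ := hM M le_rfl
      exact ⟨i, Nat.zero_le _, h2, h1⟩
    | succ k ih =>
      obtain ⟨i, hki, h1, -⟩ := ih
      obtain ⟨i', h1', h2'⟩ := hM (M + (k + 1)) (by omega)
      refine ⟨i', ?_, h2', h1'⟩
      have : (i : ℝ) < i' := by
        apply lt_of_mul_lt_mul_left _ hT.le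
        refine h1.trans_le (le_trans (le_of_eq ?_) h1')
        push_cast
        ring
      have : i < i' := by exact_mod_cast this
      omega
  obtain ⟨k, hk⟩ := exists_nat_gt (β * (M + 1) / (T - β))
  rw [div_lt_iff₀ (sub_pos.2 hβT)] at hk
  obtain ⟨i, hki, h1, -⟩ := hchain k
  have : T * k ≤ T * i := by gcongr
  push_cast at h1
  nlinarith

variable {ι : Type*} [Fintype ι]

/-- The coefficients, at the samples `β m` with `m ≤ L`, of a causal exponential sum whose past is
described by a state vector and whose nodes after `0` are `θ + T i`. The columns of the nodes are
rescaled by a fixed exponential in `θ`, so that the matrices converge for `θ → -∞`. -/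
noncomputable def phaseMatrix (a z : ι → ℂ) (k₁ : ι) (β T : ℝ) (L : ℕ) (θ : ℝ) :
    Matrix (Fin (L + 1)) (ι ⊕ Fin ⌈β * L / T⌉₊) ℂ :=
  fun m => Sum.elim (fun k => Complex.exp (z k * (β * m : ℝ))) fun i =>
    if T * i < β * m then expSum a z (β * m - T * i - θ) * Complex.exp (z k₁ * θ) else 0

/-- The limit of `phaseMatrix` for `θ → -∞`. -/
noncomputable def phaseMatrixLimit (a z : ι → ℂ) (k₁ : ι) (β T : ℝ) (L : ℕ) :
    Matrix (Fin (L + 1)) (ι ⊕ Fin ⌈β * L / T⌉₊) ℂ :=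
  fun m => Sum.elim (fun k => Complex.exp (z k * (β * m : ℝ))) fun i =>
    if T * i < β * m then a k₁ * Complex.exp (z k₁ * (β * m - T * i : ℝ)) else 0

theorem tendsto_phaseMatrix {a z : ι → ℂ} {k₁ : ι}
    (hk : ∀ k, k ≠ k₁ → a k ≠ 0 → (z k).re < (z k₁).re) (β T : ℝ) (L : ℕ) :
    Tendsto (phaseMatrix a z k₁ β T L) atBot (𝓝 (phaseMatrixLimit a z k₁ β T L)) := by
  refine tendsto_pi_nhds.2 fun m => tendsto_pi_nhds.2 fun i => ?_
  rcases i with k | i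
  · simp only [phaseMatrix, phaseMatrixLimit, Sum.elim_inl]
    exact tendsto_const_nhds
  · simp only [phaseMatrix, phaseMatrixLimit, Sum.elim_inr]
    split_ifs
    · exact tendsto_expSum_mul_exp_atBot hk _
    · exact tendsto_const_nhds

/-- In the limit all nodes emit the same exponential `μ k₁ ^ m`. Across an interval without nodes,
subtracting `μ k₁` times one row from the next removes them all and leaves an exponential sum in the
state alone. -/
theorem exists_injective_phaseMatrixLimit {a z : ι → ℂ} {k₁ : ι} {β T : ℝ} (hβ : 0 < β)
    (hβT : β < T) (hz : Function.Injective fun k => (z k).re) (ha : a k₁ ≠ 0) :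
    ∃ L : ℕ, Function.Injective (phaseMatrixLimit a z k₁ β T L).mulVec := by
  classical
  have hT : 0 < T := hβ.trans hβT
  let μ : ι → ℂ := fun k => Complex.exp (z k * β)
  have hμ0 : ∀ k, μ k ≠ 0 := fun k => Complex.exp_ne_zero _
  have hμ : Function.Injective fun k => ‖μ k‖ := by
    intro k k' h
    simp only [μ, Complex.norm_exp] at h
    have h' := Real.exp_injective h
    simp only [Complex.mul_re, Complex.ofReal_re, Complex.ofReal_im, mul_zero, sub_zero] at h'
    exact hz (mul_right_cancel₀ hβ.ne' h')
  have hμpow : ∀ k (m : ℕ), Complex.exp (z k * (β * m : ℝ)) = μ k ^ m := by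
    intro k m
    rw [← Complex.exp_nat_mul]
    congr 1
    push_cast
    ring
  obtain ⟨L, hL⟩ := exists_forall_sum_mul_pow_eq_zero hμ hμ0 (frequently_gap hβ hβT)
  refine ⟨L, ?_⟩
  rw [← Matrix.coe_mulVecLin, injective_iff_map_eq_zero]
  intro x hx
  let s : ι → ℂ := fun k => x (Sum.inl k)
  let κ : Fin ⌈β * L / T⌉₊ → ℂ := fun i => a k₁ * Complex.exp (-(z k₁ * (T * i : ℝ)))
  let d : Fin ⌈β * L / T⌉₊ → ℂ := fun i => κ i * x (Sum.inr i)
  have hκ : ∀ i, κ i ≠ 0 := fun i => mul_ne_zero ha (Complex.exp_ne_zero _)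
  have hrow : ∀ m : ℕ, m ≤ L → ∑ k, s k * μ k ^ m +
      (∑ i : Fin ⌈β * L / T⌉₊, if T * (i : ℕ) < β * m then d i else 0) * μ k₁ ^ m = 0 := by
    intro m hm
    have h := congrFun hx ⟨m, Nat.lt_succ_of_le hm⟩
    rw [Matrix.mulVecLin_apply, Matrix.mulVec, dotProduct, Fintype.sum_sum_type] at h
    simp only [phaseMatrixLimit, Sum.elim_inl, Sum.elim_inr, Pi.zero_apply, hμpow] at h
    refine Eq.trans ?_ h
    rw [Finset.sum_mul]
    congr 1
    · exact Finset.sum_congr rfl fun k _ => mul_comm _ _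
    · refine Finset.sum_congr rfl fun i _ => ?_
      split_ifs
      · rw [← hμpow]
        simp only [d, κ]
        rw [mul_right_comm, mul_assoc (a k₁), ← Complex.exp_add]
        congr 3
        push_cast
        ring
      · simp
  have hγ : (fun k => (μ k - μ k₁) * s k) = 0 := by
    refine hL _ fun m hm hmL => ?_
    have h1 := hrow m hmL.le
    have h2 := hrow (m + 1) hmL
    have h3 : (∑ i : Fin ⌈β * L / T⌉₊, if T * (i : ℕ) < β * (m + 1 : ℕ) then d i else 0) =
        ∑ i : Fin ⌈β * L / T⌉₊, if T * (i : ℕ) < β * m then d i else 0 := by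
      refine Finset.sum_congr rfl fun i _ => ?_
      have hi := hm i
      have : T * (i : ℕ) < β * (m + 1 : ℕ) ↔ T * (i : ℕ) < β * m := by
        constructor
        · intro h
          by_contra hc
          exact hi ⟨not_lt.1 hc, by simpa using h⟩
        · intro h
          refine h.trans_le ?_
          push_cast
          nlinarith
      simp only [this]
    rw [h3] at h2
    have h4 : ∑ k, (μ k - μ k₁) * s k * μ k ^ m =
        ∑ k, s k * μ k ^ (m + 1) - μ k₁ * ∑ k, s k * μ k ^ m := by
      rw [Finset.mul_sum, ← Finset.sum_sub_distrib]
      exact Finset.sum_congr rfl fun k _ => by ring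
    rw [h4]
    linear_combination h2 - μ k₁ * h1
  have hs : ∀ k, k ≠ k₁ → s k = 0 := by
    intro k hk
    have h := congrFun hγ k
    simp only [Pi.zero_apply, mul_eq_zero] at h
    refine h.resolve_left fun h0 => hk (hμ ?_)
    simp only [sub_eq_zero.1 h0]
  -- Row `0` sees no node, so it isolates the one remaining component of the state.
  have hs₁ : s k₁ = 0 := by
    have h := hrow 0 (Nat.zero_le _)
    have h0 : (∑ i : Fin ⌈β * L / T⌉₊, if T * (i : ℕ) < β * (0 : ℕ) then d i else 0) = 0 := by
      refine Finset.sum_eq_zero fun i _ => if_neg ?_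
      simp only [Nat.cast_zero, mul_zero, not_lt]
      positivity
    rw [h0, zero_mul, add_zero, Finset.sum_eq_single k₁] at h
    · simpa using h
    · intro k _ hk
      simp [hs k hk]
    · simp
  have hs' : ∀ k, s k = 0 := fun k => by
    by_cases hk : k = k₁
    · rw [hk, hs₁]
    · exact hs k hk
  have hsum : ∀ m : ℕ, m ≤ L →
      (∑ i : Fin ⌈β * L / T⌉₊, if T * (i : ℕ) < β * m then d i else 0) = 0 := by
    intro m hm
    have h := hrow m hm
    simp only [hs', zero_mul, Finset.sum_const_zero, zero_add] at h
    exact (mul_eq_zero.1 h).resolve_right (pow_ne_zero _ (hμ0 _))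
  -- The first sample strictly after node `i` precedes node `i + 1`, so it involves only `d i` and
  -- earlier coefficients, which vanish by induction.
  have hd : ∀ n : ℕ, ∀ i : Fin ⌈β * L / T⌉₊, (i : ℕ) = n → d i = 0 := by
    intro n
    induction n using Nat.strong_induction_on with
    | _ n ih =>
      intro i hin
      have hi : T * (i : ℕ) < β * L := by
        have := Nat.lt_ceil.1 i.2
        rw [lt_div_iff₀ hT] at this
        linarith
      have hiβ : (0 : ℝ) ≤ T * (i : ℕ) / β := by positivity
      set m := ⌊T * (i : ℕ) / β⌋₊ + 1 with hm
      have hm1 : T * (i : ℕ) < β * m := by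
        have := Nat.lt_floor_add_one (T * (i : ℕ) / β)
        rw [div_lt_iff₀ hβ] at this
        rw [hm]
        push_cast
        linarith
      have hm2 : β * m < T * ((i : ℕ) + 1) := by
        have := Nat.floor_le hiβ
        rw [le_div_iff₀ hβ] at this
        rw [hm]
        push_cast
        linarith
      have hmL : m ≤ L := by
        rw [hm, Nat.succ_le_iff, Nat.floor_lt hiβ, div_lt_iff₀ hβ]
        linarith
      have h := hsum m hmL
      rw [Finset.sum_eq_single i] at h
      · rwa [if_pos hm1] at h
      · intro i' _ hi'
        split_ifs with hlt
        · have h1 : ((i' : ℕ) : ℝ) < (i : ℕ) + 1 := lt_of_mul_lt_mul_left (hlt.trans hm2) hT.le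
          have h2 : (i' : ℕ) < (i : ℕ) + 1 := by exact_mod_cast h1
          have h3 : (i' : ℕ) ≠ i := fun h => hi' (Fin.ext h)
          exact ih i' (by omega) i' rfl
        · rfl
      · simp
  ext j
  rcases j with k | i
  · exact hs' k
  · exact (mul_eq_zero.1 (hd i i rfl)).resolve_left (hκ i)

end PhaseMatrix

/-! ### Good phases: analyticity and lower bounds for the phase matrix -/

section PhaseMatrixBound

variable {ι : Type*} [Fintype ι]

theorem analyticAt_cexp_mul_ofReal (c : ℂ) (x : ℝ) :
    AnalyticAt ℝ (fun θ : ℝ => Complex.exp (c * θ)) x := by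
  have h1 : AnalyticAt ℝ (fun θ : ℝ => c * (θ : ℂ)) x :=
    analyticAt_const.mul (Complex.ofRealCLM.analyticAt x)
  exact (analyticAt_cexp.restrictScalars (𝕜 := ℝ)).comp h1

theorem analyticAt_expSum_sub (a z : ι → ℂ) (y x : ℝ) :
    AnalyticAt ℝ (fun θ : ℝ => expSum a z (y - θ)) x := by
  have : (fun θ : ℝ => expSum a z (y - θ)) = fun θ : ℝ =>
      ∑ k, a k * Complex.exp (z k * y) * Complex.exp (-z k * θ) := by
    ext θ
    refine Finset.sum_congr rfl fun k _ => ?_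
    rw [mul_assoc, ← Complex.exp_add]
    congr 2
    push_cast
    ring
  rw [this]
  exact Finset.univ.analyticAt_fun_sum fun k _ =>
    analyticAt_const.mul (analyticAt_cexp_mul_ofReal _ _)

theorem analyticAt_phaseMatrix (a z : ι → ℂ) (k₁ : ι) (β T : ℝ) (L : ℕ) (x : ℝ)
    (m : Fin (L + 1)) (p : ι ⊕ Fin ⌈β * L / T⌉₊) :
    AnalyticAt ℝ (fun θ => phaseMatrix a z k₁ β T L θ m p) x := by
  rcases p with k | i
  · simp only [phaseMatrix, Sum.elim_inl]
    exact analyticAt_const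
  · simp only [phaseMatrix, Sum.elim_inr]
    split_ifs
    · exact (analyticAt_expSum_sub a z _ x).mul (analyticAt_cexp_mul_ofReal _ x)
    · exact analyticAt_const

theorem continuous_phaseMatrix (a z : ι → ℂ) (k₁ : ι) (β T : ℝ) (L : ℕ) :
    Continuous (phaseMatrix a z k₁ β T L) := by
  refine continuous_pi fun m => continuous_pi fun p => ?_
  exact continuous_iff_continuousAt.2 fun x =>
    (analyticAt_phaseMatrix a z k₁ β T L x m p).continuousAt

/-- The determinant is real analytic on all of `ℝ` and tends to `1` at `-∞`, so the identity theorem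
forbids it to vanish on `(0, ε)`. Negative phases serve only this continuation argument. -/
theorem exists_phase_det_ne_zero [DecidableEq ι] {a z : ι → ℂ} {k₁ : ι} {β T : ℝ} {L : ℕ}
    (hk : ∀ k, k ≠ k₁ → a k ≠ 0 → (z k).re < (z k₁).re)
    {G : Matrix (ι ⊕ Fin ⌈β * L / T⌉₊) (Fin (L + 1)) ℂ}
    (hG : G * phaseMatrixLimit a z k₁ β T L = 1) {ε : ℝ} (hε : 0 < ε) :
    ∃ θ ∈ Set.Ioo 0 ε, (G * phaseMatrix a z k₁ β T L θ).det ≠ 0 := by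
  by_contra! hc
  have han : AnalyticOnNhd ℝ (fun θ => (G * phaseMatrix a z k₁ β T L θ).det) Set.univ := by
    intro x _
    simp only [Matrix.det_apply]
    refine Finset.univ.analyticAt_fun_sum fun σ _ => ?_
    simp only [Units.smul_def, zsmul_eq_mul]
    refine analyticAt_const.mul (Finset.univ.analyticAt_fun_prod fun p _ => ?_)
    simp only [Matrix.mul_apply]
    exact Finset.univ.analyticAt_fun_sum fun m _ =>
      analyticAt_const.mul (analyticAt_phaseMatrix a z k₁ β T L x m p)
  have hzero : (fun θ => (G * phaseMatrix a z k₁ β T L θ).det) = 0 := by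
    have h := han.eqOn_zero_of_preconnected_of_eventuallyEq_zero (𝕜 := ℝ) isPreconnected_univ
      (Set.mem_univ (ε / 2)) (by
        filter_upwards [Ioo_mem_nhds (half_pos hε) (half_lt_self hε)] with θ hθ
        exact hc θ hθ)
    exact funext fun θ => h (Set.mem_univ θ)
  have hlim : Tendsto (fun θ => (G * phaseMatrix a z k₁ β T L θ).det) atBot (𝓝 1) := by
    have hcont : Continuous fun M : Matrix (Fin (L + 1)) (ι ⊕ Fin ⌈β * L / T⌉₊) ℂ =>
        (G * M).det := (continuous_const.matrix_mul continuous_id).matrix_det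
    have := (hcont.tendsto (phaseMatrixLimit a z k₁ β T L)).comp (tendsto_phaseMatrix hk β T L)
    rwa [hG, Matrix.det_one] at this
  rw [hzero] at hlim
  exact zero_ne_one (tendsto_nhds_unique tendsto_const_nhds hlim)

theorem Matrix.exists_leftInverse_of_mulVec_injective {m n : Type*} [Fintype m] [Fintype n]
    [DecidableEq m] [DecidableEq n] (A : Matrix m n ℂ) (hA : Function.Injective A.mulVec) :
    ∃ G : Matrix n m ℂ, G * A = 1 := by
  obtain ⟨g, hg⟩ := A.mulVecLin.exists_leftInverse_of_injective
    (LinearMap.ker_eq_bot.2 (by rwa [Matrix.coe_mulVecLin]))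
  refine ⟨LinearMap.toMatrix' g, ?_⟩
  have := congrArg LinearMap.toMatrix' hg
  rwa [LinearMap.toMatrix'_comp, LinearMap.toMatrix'_id, ← Matrix.toLin'_apply',
    LinearMap.toMatrix'_toLin'] at this

/-- If a matrix depending continuously on a parameter has a left inverse up to an invertible factor
at one parameter, then it is bounded below near that parameter. -/
theorem exists_mulVec_lower_bound {m n : Type*} [Fintype m] [Fintype n]
    [DecidableEq n] {A : ℝ → Matrix m n ℂ} (hA : Continuous A) (G : Matrix n m ℂ) {θ₀ : ℝ}
    (hdet : (G * A θ₀).det ≠ 0) :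
    ∃ C : ℝ, ∀ᶠ θ in 𝓝 θ₀, ∀ x : n → ℂ, ∀ p, ‖x p‖ ≤ C * ∑ i, ‖(A θ).mulVec x i‖ := by
  -- The adjugate is continuous in `θ` even where no inverse exists; `Q θ * A θ` is the determinant
  -- times the identity.
  let Q : ℝ → Matrix n m ℂ := fun θ => (G * A θ).adjugate * G
  have hGA : Continuous fun θ => G * A θ := continuous_const.matrix_mul hA
  have hQ : Continuous Q := hGA.matrix_adjugate.matrix_mul continuous_const
  have hQ' : ∀ p i, ∀ᶠ θ in 𝓝 θ₀, ‖Q θ p i‖ < ‖Q θ₀ p i‖ + 1 := fun p i =>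
    ((hQ.matrix_elem p i).norm.tendsto θ₀).eventually_lt_const (lt_add_one _)
  have hd : ∀ᶠ θ in 𝓝 θ₀, ‖(G * A θ₀).det‖ / 2 < ‖(G * A θ).det‖ :=
    (hGA.matrix_det.norm.tendsto θ₀).eventually_const_lt (half_lt_self (norm_pos_iff.2 hdet))
  let S : ℝ := ∑ p, ∑ i, (‖Q θ₀ p i‖ + 1)
  have hd0 : 0 < ‖(G * A θ₀).det‖ / 2 := half_pos (norm_pos_iff.2 hdet)
  refine ⟨S / (‖(G * A θ₀).det‖ / 2), ?_⟩
  have hall : ∀ᶠ θ in 𝓝 θ₀, ∀ p i, ‖Q θ p i‖ < ‖Q θ₀ p i‖ + 1 := by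
    rw [eventually_all]
    exact fun p => eventually_all.2 (hQ' p)
  filter_upwards [hd, hall] with θ h1 h2 x p
  have hx : (G * A θ).det • x = (Q θ).mulVec ((A θ).mulVec x) := by
    simp only [Q]
    rw [Matrix.mulVec_mulVec, Matrix.mul_assoc, Matrix.adjugate_mul, Matrix.smul_mulVec,
      Matrix.one_mulVec]
  have hle : ‖(G * A θ).det‖ * ‖x p‖ ≤ S * ∑ i, ‖(A θ).mulVec x i‖ := by
    have := congrArg norm (congrFun hx p)
    rw [Pi.smul_apply, smul_eq_mul, norm_mul] at this
    rw [this, Matrix.mulVec, dotProduct, Finset.mul_sum]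
    refine (norm_sum_le _ _).trans (Finset.sum_le_sum fun i _ => ?_)
    rw [norm_mul]
    refine mul_le_mul_of_nonneg_right ((h2 p i).le.trans ?_) (norm_nonneg _)
    have h3 : ‖Q θ₀ p i‖ + 1 ≤ ∑ i, (‖Q θ₀ p i‖ + 1) :=
      Finset.single_le_sum (f := fun i => ‖Q θ₀ p i‖ + 1) (fun i _ => by positivity)
        (Finset.mem_univ i)
    exact h3.trans (Finset.single_le_sum (f := fun p => ∑ i, (‖Q θ₀ p i‖ + 1))
      (fun p _ => by positivity) (Finset.mem_univ p))
  rw [div_mul_eq_mul_div, le_div_iff₀ hd0]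
  nlinarith [norm_nonneg (x p)]

theorem exists_phaseMatrix_lower_bound {a z : ι → ℂ} {β T : ℝ} (hβ : 0 < β)
    (hβT : β < T) (hz : Function.Injective fun k => (z k).re) (ha : ∃ k, a k ≠ 0) :
    ∃ k₁ : ι, ∃ L : ℕ, ∀ ε > 0, ∃ θ₀ θ₁ C : ℝ, 0 < θ₀ ∧ θ₀ < θ₁ ∧ θ₁ < ε ∧
      ∀ θ ∈ Set.Ioo θ₀ θ₁, ∀ x p, ‖x p‖ ≤ C * ∑ i, ‖(phaseMatrix a z k₁ β T L θ).mulVec x i‖ := by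
  classical
  obtain ⟨k₁, hk₁, hk⟩ := exists_dominant hz ha
  obtain ⟨L, hL⟩ := exists_injective_phaseMatrixLimit hβ hβT hz hk₁
  obtain ⟨G, hG⟩ := Matrix.exists_leftInverse_of_mulVec_injective _ hL
  refine ⟨k₁, L, fun ε hε => ?_⟩
  obtain ⟨θ, ⟨hθ0, hθε⟩, hdet⟩ := exists_phase_det_ne_zero hk hG hε
  obtain ⟨C, hC⟩ := exists_mulVec_lower_bound (continuous_phaseMatrix a z k₁ β T L) G hdet
  obtain ⟨l, u, ⟨hl, hu⟩, hlu⟩ := mem_nhds_iff_exists_Ioo_subset.1 hC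
  obtain ⟨l', hl'1, hl'2⟩ := exists_between (max_lt hl hθ0)
  obtain ⟨u', hu'1, hu'2⟩ := exists_between (lt_min hu hθε)
  refine ⟨l', u', C, (le_max_right _ _).trans_lt hl'1, hl'2.trans hu'1,
    hu'2.trans_le (min_le_right _ _), fun x hx => ?_⟩
  exact hlu ⟨(le_max_left _ _).trans_lt (hl'1.trans hx.1),
    hx.2.trans (hu'2.trans_le (min_le_left _ _))⟩

end PhaseMatrixBound

/-! ### State vectors and samples of causal series -/

section CausalSeries

variable {ι : Type*}

/-- The contribution of the nodes before the `j`-th one to the `k`-th exponential, at the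
`j`-th node. -/
noncomputable def pastState (a z : ι → ℂ) (T : ℝ) (c : ℤ → ℂ) (j : ℤ) (k : ι) : ℂ :=
  a k * ∑' l : ℕ, c (j - 1 - l) * Complex.exp (z k * (T * (l + 1) : ℝ))

variable {a z : ι → ℂ} {β T : ℝ} {c : ℤ → ℂ}

theorem norm_exp_mul_ofReal_le_one {w : ℂ} (hw : w.re < 0) {x : ℝ} (hx : 0 ≤ x) :
    ‖Complex.exp (w * x)‖ ≤ 1 := by
  rw [Complex.norm_exp, Real.exp_le_one_iff, Complex.re_mul_ofReal]
  exact mul_nonpos_of_nonpos_of_nonneg hw.le hx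

theorem summable_mul_exp_of_bounded {w : ℂ} (hw : w.re < 0) (hT : 0 < T) {d : ℕ → ℂ} {M : ℝ}
    (hd : ∀ l, ‖d l‖ ≤ M) :
    Summable fun l : ℕ => d l * Complex.exp (w * (T * (l + 1) : ℝ)) := by
  have hlt : ‖Complex.exp (w * T)‖ < 1 := by
    rw [Complex.norm_exp, Real.exp_lt_one_iff, Complex.re_mul_ofReal]
    exact mul_neg_of_neg_of_pos hw hT
  have hgeo : Summable fun l : ℕ => M * ‖Complex.exp (w * T)‖ ^ (l + 1) :=
    ((summable_nat_add_iff 1).2 (summable_geometric_of_lt_one (norm_nonneg _) hlt)).mul_left M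
  refine Summable.of_norm_bounded hgeo fun l => ?_
  have he : Complex.exp (w * (T * (l + 1) : ℝ)) = Complex.exp (w * T) ^ (l + 1) := by
    rw [← Complex.exp_nat_mul]
    congr 1
    push_cast
    ring
  rw [norm_mul, he, norm_pow]
  exact mul_le_mul_of_nonneg_right (hd l) (by positivity)

theorem pastState_succ (hz : ∀ k, (z k).re < 0) (hT : 0 < T) (hc : ∃ M, ∀ i, ‖c i‖ ≤ M)
    (j : ℤ) (k : ι) :
    pastState a z T c (j + 1) k = Complex.exp (z k * T) * (pastState a z T c j k + a k * c j) := by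
  obtain ⟨M, hM⟩ := hc
  have hs := summable_mul_exp_of_bounded (hz k) hT (d := fun l => c (j + 1 - 1 - l))
    fun l => hM _
  rw [pastState, hs.tsum_eq_zero_add, pastState]
  have h1 : ∀ l : ℕ, c (j + 1 - 1 - (l + 1 : ℕ)) * Complex.exp (z k * (T * ((l + 1 : ℕ) + 1) : ℝ)) =
      Complex.exp (z k * T) * (c (j - 1 - l) * Complex.exp (z k * (T * (l + 1) : ℝ))) := by
    intro l
    have e1 : j + 1 - 1 - ((l + 1 : ℕ) : ℤ) = j - 1 - l := by push_cast; ring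
    rw [e1, mul_left_comm, ← Complex.exp_add]
    congr 2
    push_cast
    ring
  simp only [h1]
  rw [tsum_mul_left]
  simp
  ring

variable [Fintype ι]

/-- The exponential sum cut off to the positive half-line. -/
noncomputable def causalExpSum (a z : ι → ℂ) (τ : ℝ) : ℂ :=
  if 0 < τ then expSum a z τ else 0

/-- The values at `β m` of the superposition of the causal exponential sums started at the nodes
`η + T i`, with coefficients `c i`. -/
noncomputable def nodeSamples (a z : ι → ℂ) (β T η : ℝ) (c : ℤ → ℂ) (m : ℤ) : ℂ :=
  ∑' i : ℤ, c i * causalExpSum a z (β * m - (η + T * i))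

/-- By `hjm` all nodes before the `j`-th precede the sample, so the cutoff is inactive there and
their exponentials factor through the state. Of the other nodes only those in `s` can precede the
sample. -/
theorem nodeSamples_eq (hz : ∀ k, (z k).re < 0) (hT : 0 < T) (hc : ∃ M, ∀ i, ‖c i‖ ≤ M)
    {η : ℝ} {j m : ℤ} (hjm : η + T * j - T < β * m) {s : Finset ℕ}
    (hs : ∀ i : ℕ, η + T * j + T * i < β * m → i ∈ s) :
    nodeSamples a z β T η c m =
      ∑ k, Complex.exp (z k * (β * m - (η + T * j) : ℝ)) * pastState a z T c j k +
      ∑ i ∈ s, c (j + i) * causalExpSum a z (β * m - (η + T * j) - T * i) := by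
  obtain ⟨M, hM⟩ := hc
  set x := β * m - (η + T * j) with hx
  have hfut : HasSum (fun i : ℕ => c (j + i) * causalExpSum a z (β * m - (η + T * (j + i : ℤ))))
      (∑ i ∈ s, c (j + i) * causalExpSum a z (x - T * i)) := by
    have : ∀ i : ℕ, β * m - (η + T * (j + i : ℤ)) = x - T * i := by
      intro i; rw [hx]; push_cast; ring
    simp only [this]
    apply hasSum_sum_of_ne_finset_zero
    intro i hi
    rw [causalExpSum, if_neg, mul_zero]
    intro h
    exact hi (hs i (by linarith))
  have hpast : HasSum (fun l : ℕ => c (j + -(l + 1 : ℤ)) *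
      causalExpSum a z (β * m - (η + T * (j + -(l + 1 : ℤ) : ℤ))))
      (∑ k, Complex.exp (z k * x) * pastState a z T c j k) := by
    have : ∀ l : ℕ, c (j + -(l + 1 : ℤ)) *
        causalExpSum a z (β * m - (η + T * (j + -(l + 1 : ℤ) : ℤ))) =
        ∑ k, Complex.exp (z k * x) *
          (a k * (c (j - 1 - l) * Complex.exp (z k * (T * (l + 1) : ℝ)))) := by
      intro l
      have h0 : 0 < β * m - (η + T * (j + -(l + 1 : ℤ) : ℤ)) := by
        push_cast
        nlinarith [mul_nonneg hT.le (Nat.cast_nonneg (α := ℝ) l)]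
      have e1 : j + -(l + 1 : ℤ) = j - 1 - l := by ring
      rw [causalExpSum, if_pos h0, expSum, Finset.mul_sum, ← e1]
      refine Finset.sum_congr rfl fun k _ => ?_
      have e2 : z k * ((β * m - (η + T * (j + -(l + 1 : ℤ) : ℤ)) : ℝ) : ℂ) =
          z k * x + z k * (T * (l + 1) : ℝ) := by
        rw [hx]
        push_cast
        ring
      rw [e2, Complex.exp_add]
      ring
    simp only [this]
    refine hasSum_sum fun k _ => ?_
    exact ((summable_mul_exp_of_bounded (hz k) hT (d := fun l => c (j - 1 - l))
      fun l => hM _).hasSum.mul_left (a k)).mul_left _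
  have hall : HasSum (fun i : ℤ => c (j + i) *
      causalExpSum a z (β * m - (η + T * (j + i : ℤ))))
      (∑ i ∈ s, c (j + i) * causalExpSum a z (x - T * i) +
        ∑ k, Complex.exp (z k * x) * pastState a z T c j k) :=
    HasSum.of_nat_of_neg_add_one hfut hpast
  rw [nodeSamples, add_comm, ← hall.tsum_eq]
  exact ((Equiv.addLeft j).tsum_eq
    fun i : ℤ => c i * causalExpSum a z (β * m - (η + T * i))).symm

/-- Near a suitable phase, the state is controlled by finitely many samples. -/
theorem exists_pastState_bound (hz : ∀ k, (z k).re < 0)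
    (hz' : Function.Injective fun k => (z k).re) (ha : ∃ k, a k ≠ 0) (hβ : 0 < β) (hβT : β < T) :
    ∃ L : ℕ, ∃ θ₀ θ₁ C : ℝ, θ₀ < θ₁ ∧ 0 ≤ C ∧ ∀ c : ℤ → ℂ, (∃ M, ∀ i, ‖c i‖ ≤ M) →
      ∀ (η : ℝ) (j n : ℤ), η + T * j - β * n ∈ Set.Ioo θ₀ θ₁ → 0 ≤ η + T * j - β * n ∧
        η + T * j - β * n < T ∧
        ∀ k, ‖pastState a z T c j k‖ ≤
          C * ∑ m ∈ Finset.range (L + 1), ‖nodeSamples a z β T η c (n + m)‖ := by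
  have hT : 0 < T := hβ.trans hβT
  obtain ⟨k₁, L, h⟩ := exists_phaseMatrix_lower_bound hβ hβT hz' ha
  -- `phaseMatrix` decides by `T i < β m`, while causality asks for `T i + θ < β m`; for `0 < θ < ε`
  -- the two agree.
  obtain ⟨ε, hε, hεT, hpat⟩ : ∃ ε > 0, ε < T ∧ ∀ m : Fin (L + 1), ∀ i : Fin ⌈β * L / T⌉₊,
      T * (i : ℕ) < β * (m : ℕ) → T * (i : ℕ) + ε < β * (m : ℕ) := by
    have hev : ∀ᶠ ε in 𝓝[>] (0 : ℝ), ∀ m : Fin (L + 1), ∀ i : Fin ⌈β * L / T⌉₊,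
        T * (i : ℕ) < β * (m : ℕ) → T * (i : ℕ) + ε < β * (m : ℕ) := by
      rw [eventually_all]
      intro m
      rw [eventually_all]
      intro i
      by_cases hlt : T * (i : ℕ) < β * (m : ℕ)
      · have := Ioo_mem_nhdsGT (sub_pos.2 hlt)
        filter_upwards [this] with ε hε _
        linarith [hε.2]
      · exact Eventually.of_forall fun ε h => absurd h hlt
    obtain ⟨ε, h1, h2⟩ := (hev.and (Ioo_mem_nhdsGT hT)).exists
    exact ⟨ε, h2.1, h2.2, h1⟩
  obtain ⟨θ₀, θ₁, C, h0, h01, h1, hC⟩ := h ε hε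
  refine ⟨L, θ₀, θ₁, max C 0 * Real.exp (∑ k, |(z k).re| * T), h01, by positivity,
    fun c hc η j n hθ => ?_⟩
  set θ := η + T * j - β * n with hθdef
  have hθ0 : 0 < θ := h0.trans hθ.1
  have hθε : θ < ε := hθ.2.trans h1
  refine ⟨hθ0.le, hθε.trans hεT, fun k => ?_⟩
  -- The state is transported from the node back to `β n`, and the coefficients undo the rescaling
  -- of the node columns.
  let x : ι ⊕ Fin ⌈β * L / T⌉₊ → ℂ := Sum.elim
    (fun k => Complex.exp (-(z k * θ)) * pastState a z T c j k)
    fun i => Complex.exp (-(z k₁ * θ)) * c (j + (i : ℕ))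
  have hmul : ∀ m : Fin (L + 1), (phaseMatrix a z k₁ β T L θ).mulVec x m =
      nodeSamples a z β T η c (n + (m : ℕ)) := by
    intro m
    have hm : ((m : ℕ) : ℝ) ≤ L := by exact_mod_cast Nat.lt_succ_iff.1 m.2
    rw [nodeSamples_eq (a := a) hz hT hc (j := j) (s := Finset.range ⌈β * L / T⌉₊),
      Matrix.mulVec, dotProduct, Fintype.sum_sum_type, Finset.sum_range]
    · congr 1
      · refine Finset.sum_congr rfl fun k _ => ?_
        simp only [phaseMatrix, Sum.elim_inl, x]
        rw [← mul_assoc, ← Complex.exp_add]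
        congr 2
        rw [hθdef]
        push_cast
        ring
      · refine Finset.sum_congr rfl fun i _ => ?_
        simp only [phaseMatrix, Sum.elim_inr, x]
        have e : β * ((n + (m : ℕ) : ℤ) : ℝ) - (η + T * j) - T * (i : ℕ) =
            β * (m : ℕ) - T * (i : ℕ) - θ := by
          rw [hθdef]; push_cast; ring
        rw [e, causalExpSum]
        by_cases hlt : T * (i : ℕ) < β * (m : ℕ)
        · have h' := hpat m i hlt
          rw [if_pos hlt, if_pos (by linarith)]
          have : Complex.exp (z k₁ * θ) * Complex.exp (-(z k₁ * θ)) = 1 := by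
            rw [← Complex.exp_add]; simp
          linear_combination (expSum a z (β * (m : ℕ) - T * (i : ℕ) - θ) * c (j + (i : ℕ))) * this
        · rw [if_neg hlt, if_neg (by linarith)]
          simp
    · push_cast
      nlinarith [mul_nonneg hβ.le (Nat.cast_nonneg (α := ℝ) (m : ℕ))]
    · intro i hi
      push_cast at hi
      rw [Finset.mem_range, Nat.lt_ceil, lt_div_iff₀ hT]
      have : β * ((m : ℕ) : ℝ) ≤ β * L := by gcongr
      nlinarith
  have hk := hC θ hθ x (Sum.inl k)
  simp only [hmul] at hk
  rw [Fin.sum_univ_eq_sum_range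
    (fun m : ℕ => ‖nodeSamples a z β T η c (n + (m : ℤ))‖) (L + 1)] at hk
  have hS : 0 ≤ ∑ m ∈ Finset.range (L + 1), ‖nodeSamples a z β T η c (n + (m : ℤ))‖ :=
    Finset.sum_nonneg fun _ _ => norm_nonneg _
  have hexp : pastState a z T c j k = Complex.exp (z k * θ) * x (Sum.inl k) := by
    simp only [x, Sum.elim_inl]
    rw [← mul_assoc, ← Complex.exp_add]
    simp
  have hexp' : ‖Complex.exp (z k * θ)‖ ≤ Real.exp (∑ k, |(z k).re| * T) := by
    refine (norm_exp_mul_ofReal_le_one (hz k) hθ0.le).trans (Real.one_le_exp ?_)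
    positivity
  rw [hexp, norm_mul]
  calc _ ≤ Real.exp (∑ k, |(z k).re| * T) * (max C 0 *
        ∑ m ∈ Finset.range (L + 1), ‖nodeSamples a z β T η c (n + (m : ℤ))‖) := by
        gcongr
        exact hk.trans (mul_le_mul_of_nonneg_right (le_max_left _ _) hS)
    _ = _ := by ring

end CausalSeries

/-! ### Recurrence to good phases and counting of lattice points -/

section LatticePoints

/-- Every real number is carried into a given interval by a bounded number of backward steps of
length `T` and an integer number of steps of length `β`, if `β / T` is irrational. -/
theorem exists_bounded_return {β T : ℝ} (hβ : 0 < β) (hirr : Irrational (β / T)) {θ₀ θ₁ : ℝ}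
    (hθ : θ₀ < θ₁) :
    ∃ K : ℕ, ∀ η : ℝ, ∃ l : ℕ, l ≤ K ∧ ∃ n : ℤ, η - T * l - β * n ∈ Set.Ioo θ₀ θ₁ := by
  -- A positive element `g = q β + p T` shorter than the interval: repeated steps by `g` cannot jump
  -- over it.
  obtain ⟨g, hg, hg0, hgθ⟩ := (dense_addSubgroupClosure_pair_iff.2 hirr).exists_between
    (sub_pos.2 hθ)
  obtain ⟨q, p, hpq⟩ := AddSubgroup.mem_closure_pair.1 hg
  simp only [zsmul_eq_mul] at hpq
  obtain ⟨M, hM⟩ := exists_nat_gt (β / g + 1)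
  -- The sign of `p` is unknown. Starting `M |p|` nodes back keeps the number of backward steps `M
  -- |p| - k p` between `0` and `2 M |p|` for `k ≤ M`.
  refine ⟨2 * (M * p.natAbs), fun η => ?_⟩
  set η' := η - T * (M * p.natAbs : ℕ) with hη'
  set n₀ := ⌈(η' - θ₀) / β⌉ with hn₀
  have hx1 : η' - β * n₀ ≤ θ₀ := by
    have := Int.le_ceil ((η' - θ₀) / β)
    rw [div_le_iff₀ hβ] at this
    linarith
  have hx2 : θ₀ - β < η' - β * n₀ := by
    have := Int.ceil_lt_add_one ((η' - θ₀) / β)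
    rw [← sub_lt_iff_lt_add, lt_div_iff₀ hβ] at this
    linarith
  set x := η' - β * n₀ with hx
  have hnn : 0 ≤ (θ₀ - x) / g := div_nonneg (by linarith) hg0.le
  set k := ⌊(θ₀ - x) / g⌋₊ + 1 with hk
  have hk1 : θ₀ < x + k * g := by
    have := Nat.lt_floor_add_one ((θ₀ - x) / g)
    rw [div_lt_iff₀ hg0] at this
    rw [hk]
    push_cast
    linarith
  have hk2 : x + k * g < θ₁ := by
    have := Nat.floor_le hnn
    rw [le_div_iff₀ hg0] at this
    rw [hk]
    push_cast
    linarith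
  have hkM : k ≤ M := by
    have h1 := Nat.floor_le hnn
    have h2 : (θ₀ - x) / g ≤ β / g := by
      gcongr
      linarith
    have h3 : (k : ℝ) < M := by
      rw [hk]
      push_cast
      linarith
    exact_mod_cast h3.le
  have hkp : ((k : ℤ) * p).natAbs ≤ M * p.natAbs := by
    rw [Int.natAbs_mul, Int.natAbs_natCast]
    gcongr
  refine ⟨(((M * p.natAbs : ℕ) : ℤ) - k * p).toNat, by omega, n₀ - k * q, ?_⟩
  have hl : (((((M * p.natAbs : ℕ) : ℤ) - k * p).toNat : ℕ) : ℝ) =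
      ((M * p.natAbs : ℕ) : ℝ) - k * p := by
    rw [← Int.cast_natCast, Int.toNat_of_nonneg (by omega), Int.cast_sub, Int.cast_mul,
      Int.cast_natCast, Int.cast_natCast]
  have e : η - T * (((((M * p.natAbs : ℕ) : ℤ) - k * p).toNat : ℕ) : ℝ) -
      β * ((n₀ - k * q : ℤ) : ℝ) = x + k * g := by
    rw [hl, hx, hη', ← hpq]
    push_cast
    ring
  rw [e]
  exact ⟨hk1, hk2⟩

theorem exists_finset_abs_sub_le {T : ℝ} (hT : 0 < T) (R : ℝ) :
    ∃ P : ℕ, ∀ x : ℝ, ∃ s : Finset ℤ, s.card ≤ P ∧ ∀ j : ℤ, j ∈ s ↔ |x - T * j| ≤ R := by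
  refine ⟨⌈2 * R / T⌉₊ + 1, fun x => ⟨Finset.Icc ⌈(x - R) / T⌉ ⌊(x + R) / T⌋, ?_, fun j => ?_⟩⟩
  · rw [Int.card_Icc, Int.toNat_le]
    have h1 := Int.floor_le ((x + R) / T)
    have h2 := Int.le_ceil ((x - R) / T)
    have h3 := Nat.le_ceil (2 * R / T)
    have h4 : (x + R) / T - (x - R) / T = 2 * R / T := by ring
    have : ((⌊(x + R) / T⌋ + 1 - ⌈(x - R) / T⌉ : ℤ) : ℝ) ≤ ((⌈2 * R / T⌉₊ + 1 : ℕ) : ℤ) := by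
      push_cast
      linarith
    exact_mod_cast this
  · rw [Finset.mem_Icc, Int.ceil_le, Int.le_floor, div_le_iff₀ hT, le_div_iff₀ hT, abs_le]
    constructor
    · rintro ⟨h1, h2⟩
      constructor <;> linarith
    · rintro ⟨h1, h2⟩
      constructor <;> linarith

end LatticePoints

/-! ### The lower bound for sequences -/

section LowerBound

variable {ι : Type*} [Fintype ι] {a z : ι → ℂ} {β T : ℝ}

/-- A single sample is used, at distance in `[T - β, T)` after node `j`. It precedes node `j + 1`,
and on the compact interval `[T - β, T]`, away from `0`, the exponential sum is bounded below in
modulus. -/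
theorem exists_coeff_step_bound (hz : ∀ k, (z k).re < 0) (hβ : 0 < β) (hβT : β < T)
    (hH : ∀ τ : ℝ, 0 < τ → expSum a z τ ≠ 0) :
    ∃ B : ℝ, 0 ≤ B ∧ ∀ c : ℤ → ℂ, (∃ M, ∀ i, ‖c i‖ ≤ M) → ∀ (η S : ℝ) (j : ℤ),
      (∀ m : ℤ, |β * m - (η + T * j)| ≤ T → ‖nodeSamples a z β T η c m‖ ≤ S) →
      ‖c j‖ ≤ B * (S + ∑ k, ‖pastState a z T c j k‖) ∧
      ∑ k, ‖pastState a z T c (j + 1) k‖ ≤ B * (S + ∑ k, ‖pastState a z T c j k‖) := by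
  have hT : 0 < T := hβ.trans hβT
  obtain ⟨τ₀, hτ₀, hmin⟩ := (isCompact_Icc (a := T - β) (b := T)).exists_isMinOn
    (Set.nonempty_Icc.2 (by linarith)) (continuous_expSum a z).norm.continuousOn
  have hκ : 0 < ‖expSum a z τ₀‖ := norm_pos_iff.2 (hH _ (by linarith [hτ₀.1]))
  set κ := ‖expSum a z τ₀‖
  set A := ∑ k, ‖a k‖ with hA
  have hA0 : 0 ≤ A := Finset.sum_nonneg fun _ _ => norm_nonneg _
  -- Recovering `c j` costs `κ⁻¹`, advancing the state costs `1 + A * κ⁻¹`; the sum serves both.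
  refine ⟨1 + (1 + A) * κ⁻¹, by positivity, fun c hc η S j hS => ?_⟩
  set y := η + T * j with hy
  set ρ := ∑ k, ‖pastState a z T c j k‖ with hρ
  have hρ0 : 0 ≤ ρ := Finset.sum_nonneg fun _ _ => norm_nonneg _
  set m := ⌈(y + (T - β)) / β⌉ with hm
  have hm1 : T - β ≤ β * m - y := by
    have := Int.le_ceil ((y + (T - β)) / β)
    rw [div_le_iff₀ hβ] at this
    linarith
  have hm2 : β * m - y < T := by
    have := Int.ceil_lt_add_one ((y + (T - β)) / β)
    rw [← sub_lt_iff_lt_add, lt_div_iff₀ hβ] at this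
    linarith
  have hu := hS m (abs_le.2 ⟨by linarith, hm2.le⟩)
  have hS0 : 0 ≤ S := (norm_nonneg _).trans hu
  have heq := nodeSamples_eq (a := a) (β := β) hz hT hc (η := η) (j := j) (m := m)
    (s := {0}) (by linarith) (by
      intro i hi
      rw [Finset.mem_singleton]
      by_contra hi0
      have h1 : (1 : ℝ) ≤ i := by exact_mod_cast Nat.one_le_iff_ne_zero.2 hi0
      nlinarith)
  rw [Finset.sum_singleton, ← hy] at heq
  simp only [Nat.cast_zero, add_zero, mul_zero, sub_zero] at heq
  rw [causalExpSum, if_pos (by linarith)] at heq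
  have hpast : ‖∑ k, Complex.exp (z k * (β * m - y : ℝ)) * pastState a z T c j k‖ ≤ ρ := by
    refine (norm_sum_le _ _).trans (Finset.sum_le_sum fun k _ => ?_)
    rw [norm_mul]
    exact mul_le_of_le_one_left (norm_nonneg _)
      (norm_exp_mul_ofReal_le_one (hz k) (by linarith))
  have hκle : κ ≤ ‖expSum a z (β * m - y)‖ := hmin ⟨hm1, hm2.le⟩
  have hcκ : ‖c j‖ * κ ≤ S + ρ := by
    have h1 : c j * expSum a z (β * m - y) = nodeSamples a z β T η c m -
        ∑ k, Complex.exp (z k * (β * m - y : ℝ)) * pastState a z T c j k := by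
      rw [heq]; ring
    calc ‖c j‖ * κ ≤ ‖c j‖ * ‖expSum a z (β * m - y)‖ := by gcongr
      _ = ‖nodeSamples a z β T η c m -
        ∑ k, Complex.exp (z k * (β * m - y : ℝ)) * pastState a z T c j k‖ := by
          rw [← norm_mul, h1]
      _ ≤ S + ρ := (norm_sub_le _ _).trans (add_le_add hu hpast)
  have hcj : ‖c j‖ ≤ κ⁻¹ * (S + ρ) := by
    rw [inv_mul_eq_div, le_div_iff₀ hκ]
    exact hcκ
  have hSρ : 0 ≤ S + ρ := by positivity
  constructor
  · refine hcj.trans (mul_le_mul_of_nonneg_right ?_ hSρ)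
    have : 0 ≤ A * κ⁻¹ := by positivity
    linarith
  · calc ∑ k, ‖pastState a z T c (j + 1) k‖
        ≤ ∑ k, (‖pastState a z T c j k‖ + ‖a k‖ * ‖c j‖) := by
          refine Finset.sum_le_sum fun k _ => ?_
          rw [pastState_succ hz hT hc, norm_mul]
          refine (mul_le_of_le_one_left (norm_nonneg _)
            (norm_exp_mul_ofReal_le_one (hz k) hT.le)).trans ?_
          rw [← norm_mul]
          exact norm_add_le _ _
      _ = ρ + A * ‖c j‖ := by rw [Finset.sum_add_distrib, ← Finset.sum_mul]
      _ ≤ ρ + A * (κ⁻¹ * (S + ρ)) := by gcongr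
      _ ≤ _ := by
        have : 0 ≤ κ⁻¹ * (S + ρ) := by positivity
        nlinarith

/-- At most `K` nodes back the phase is good and the state is bounded by samples; the step bound
carries this estimate forward to node `j`. -/
theorem exists_coeff_bound (hz : ∀ k, (z k).re < 0)
    (hz' : Function.Injective fun k => (z k).re) (hβ : 0 < β) (hβT : β < T)
    (hirr : Irrational (β / T)) (hH : ∀ τ : ℝ, 0 < τ → expSum a z τ ≠ 0) :
    ∃ C R : ℝ, 0 ≤ C ∧ ∀ c : ℤ → ℂ, (∃ M, ∀ i, ‖c i‖ ≤ M) → ∀ (η S : ℝ) (j : ℤ), 0 ≤ S →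
      (∀ m : ℤ, |β * m - (η + T * j)| ≤ R → ‖nodeSamples a z β T η c m‖ ≤ S) →
      ‖c j‖ ≤ C * S := by
  have hT : 0 < T := hβ.trans hβT
  have ha : ∃ k, a k ≠ 0 := by
    by_contra! h
    exact hH 1 one_pos (by simp [expSum, h])
  obtain ⟨L, θ₀, θ₁, C₀, hθ, hC₀, hphase⟩ := exists_pastState_bound hz hz' ha hβ hβT
  obtain ⟨K, hK⟩ := exists_bounded_return hβ hirr hθ
  obtain ⟨B, hB, hstep⟩ := exists_coeff_step_bound hz hβ hβT hH
  set C₁ : ℝ := (∑ _k : ι, C₀ * (L + 1)) with hC₁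
  have hC₁0 : 0 ≤ C₁ := Finset.sum_nonneg fun _ _ => by positivity
  set D : ℝ := 2 * (B + 1) with hD
  have hD1 : 1 ≤ D := by linarith
  -- The radius allows for `K` steps back, the reach `T` of a step or of the phase offset, and `L`
  -- further samples. Each step multiplies a bound `E * S` with `E ≥ 1` by at most `D`.
  refine ⟨D * (D ^ K * (C₁ + 1)), K * T + T + β * L, by positivity, fun c hc η S j hS0 hS => ?_⟩
  obtain ⟨l, hlK, n, hn⟩ := hK (η + T * j)
  have hlT : (l : ℝ) * T ≤ K * T := by
    have : (l : ℝ) ≤ K := by exact_mod_cast hlK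
    gcongr
  have hβL : 0 ≤ β * L := by positivity
  have e : η + T * j - T * l - β * n = η + T * ((j - l : ℤ) : ℝ) - β * n := by
    push_cast; ring
  rw [e] at hn
  obtain ⟨hn0, hnT, hpast⟩ := hphase c hc η (j - l) n hn
  push_cast at hn0 hnT
  have hlT0 : 0 ≤ (l : ℝ) * T := by positivity
  have hbase : ∑ k, ‖pastState a z T c (j - l) k‖ ≤ C₁ * S := by
    rw [hC₁, Finset.sum_mul]
    refine Finset.sum_le_sum fun k _ => (hpast k).trans ?_
    rw [mul_assoc]
    refine mul_le_mul_of_nonneg_left ?_ hC₀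
    have : ∀ m ∈ Finset.range (L + 1), ‖nodeSamples a z β T η c (n + m)‖ ≤ S := by
      intro m hm
      have hmL : (m : ℝ) ≤ L := by exact_mod_cast Nat.lt_succ_iff.1 (Finset.mem_range.1 hm)
      have h1 : β * m ≤ β * L := by gcongr
      have h2 : 0 ≤ β * m := by positivity
      apply hS
      push_cast
      rw [abs_le]
      constructor <;> nlinarith
    refine (Finset.sum_le_sum this).trans (le_of_eq ?_)
    simp
  have hind : ∀ p : ℕ, p ≤ l →
      ∑ k, ‖pastState a z T c (j - l + p) k‖ ≤ D ^ p * (C₁ + 1) * S := by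
    intro p
    induction p with
    | zero =>
      intro _
      simp only [Nat.cast_zero, add_zero, pow_zero, one_mul]
      linarith
    | succ p ih =>
      intro hp
      have hpl : (p : ℝ) ≤ l := by exact_mod_cast (Nat.le_succ p).trans hp
      have h := (hstep c hc η S (j - l + p) (by
        intro m hm
        apply hS
        push_cast at hm
        rw [abs_le] at hm ⊢
        have h1 : T * p ≤ T * l := by gcongr
        have h2 : 0 ≤ T * p := by positivity
        constructor <;> nlinarith)).2
      have ih' := ih ((Nat.le_succ p).trans hp)
      have hDp : 1 ≤ D ^ p := one_le_pow₀ hD1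
      have h3 : S ≤ D ^ p * (C₁ + 1) * S := by
        refine le_mul_of_one_le_left hS0 ?_
        nlinarith
      rw [show j - l + ((p + 1 : ℕ) : ℤ) = j - l + p + 1 by push_cast; ring]
      refine h.trans ?_
      calc _ ≤ B * (D ^ p * (C₁ + 1) * S + D ^ p * (C₁ + 1) * S) := by gcongr
        _ ≤ (B + 1) * (D ^ p * (C₁ + 1) * S + D ^ p * (C₁ + 1) * S) := by
          refine mul_le_mul_of_nonneg_right (by linarith) (by positivity)
        _ = _ := by rw [pow_succ, hD]; ring
  have hρ := hind l le_rfl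
  rw [sub_add_cancel] at hρ
  have hc' := (hstep c hc η S j (by
    intro m hm
    apply hS
    have : 0 ≤ (K : ℝ) * T := by positivity
    linarith)).1
  have hDl : D ^ l ≤ D ^ K := pow_le_pow_right₀ hD1 hlK
  have hDK : 1 ≤ D ^ K := one_le_pow₀ hD1
  have h3 : S ≤ D ^ K * (C₁ + 1) * S := by
    refine le_mul_of_one_le_left hS0 ?_
    nlinarith
  calc ‖c j‖ ≤ B * (D ^ K * (C₁ + 1) * S + D ^ K * (C₁ + 1) * S) := by
        refine hc'.trans (mul_le_mul_of_nonneg_left (add_le_add h3 (hρ.trans ?_)) hB)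
        gcongr
    _ ≤ (B + 1) * (D ^ K * (C₁ + 1) * S + D ^ K * (C₁ + 1) * S) := by
        refine mul_le_mul_of_nonneg_right (by linarith) (by positivity)
    _ = _ := by rw [hD]; ring

theorem exists_tsum_coeff_le (hz : ∀ k, (z k).re < 0)
    (hz' : Function.Injective fun k => (z k).re) (hβ : 0 < β) (hβT : β < T)
    (hirr : Irrational (β / T)) (hH : ∀ τ : ℝ, 0 < τ → expSum a z τ ≠ 0) :
    ∃ C : NNReal, ∀ c : ℤ → ℂ, (∃ M, ∀ i, ‖c i‖ ≤ M) → ∀ η : ℝ,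
      ∑' j, ‖c j‖ₑ ^ 2 ≤ C * ∑' m, ‖nodeSamples a z β T η c m‖ₑ ^ 2 := by
  classical
  have hT : 0 < T := hβ.trans hβT
  obtain ⟨C, R, hC, hbound⟩ := exists_coeff_bound hz hz' hβ hβT hirr hH
  obtain ⟨P, hP⟩ := exists_finset_abs_sub_le hT R
  obtain ⟨P', hP'⟩ := exists_finset_abs_sub_le hβ R
  lift C to NNReal using hC
  refine ⟨C ^ 2 * P, fun c hc η => ?_⟩
  set u := nodeSamples a z β T η c with hu
  have hj : ∀ j : ℤ, ‖c j‖ₑ ^ 2 ≤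
      (C : ENNReal) ^ 2 * ∑' m : ℤ, if |β * m - (η + T * j)| ≤ R then ‖u m‖ₑ ^ 2 else 0 := by
    intro j
    obtain ⟨s, -, hs⟩ := hP' (η + T * j)
    have hs' : ∀ m : ℤ, m ∈ s ↔ |β * m - (η + T * j)| ≤ R := fun m => by rw [hs, abs_sub_comm]
    -- The local supremum is replaced by a local `ℓ²` norm; after summation over `j` each sample is
    -- counted at most `P` times.
    have h1 : ‖c j‖ ≤ C * √(∑ m ∈ s, ‖u m‖ ^ 2) := by
      refine hbound c hc η _ j (Real.sqrt_nonneg _) fun m hm => Real.le_sqrt_of_sq_le ?_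
      exact Finset.single_le_sum (f := fun m => ‖u m‖ ^ 2) (fun _ _ => by positivity)
        ((hs' m).2 hm)
    have h2 : ‖c j‖ ^ 2 ≤ (C : ℝ) ^ 2 * ∑ m ∈ s, ‖u m‖ ^ 2 := by
      calc ‖c j‖ ^ 2 ≤ (C * √(∑ m ∈ s, ‖u m‖ ^ 2)) ^ 2 := by gcongr
        _ = _ := by
          rw [mul_pow, Real.sq_sqrt (Finset.sum_nonneg fun _ _ => by positivity)]
    have h3 : ‖c j‖₊ ^ 2 ≤ C ^ 2 * ∑ m ∈ s, ‖u m‖₊ ^ 2 := by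
      rw [← NNReal.coe_le_coe]
      push_cast
      exact h2
    calc ‖c j‖ₑ ^ 2 ≤ (C : ENNReal) ^ 2 * ∑ m ∈ s, ‖u m‖ₑ ^ 2 := by
          simp only [enorm_eq_nnnorm]
          exact_mod_cast h3
      _ ≤ _ := by
          gcongr
          refine le_trans (le_of_eq ?_) (ENNReal.sum_le_tsum s)
          exact Finset.sum_congr rfl fun m hm => by rw [if_pos ((hs' m).1 hm)]
  calc ∑' j, ‖c j‖ₑ ^ 2 ≤ ∑' j : ℤ, (C : ENNReal) ^ 2 *
        ∑' m : ℤ, (if |β * m - (η + T * j)| ≤ R then ‖u m‖ₑ ^ 2 else 0) := ENNReal.tsum_le_tsum hj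
    _ = (C : ENNReal) ^ 2 * ∑' m : ℤ, ∑' j : ℤ,
        (if |β * m - (η + T * j)| ≤ R then ‖u m‖ₑ ^ 2 else 0) := by
        rw [ENNReal.tsum_mul_left, ENNReal.tsum_comm]
    _ ≤ (C : ENNReal) ^ 2 * ∑' m : ℤ, P * ‖u m‖ₑ ^ 2 := by
        gcongr with m
        obtain ⟨s, hsP, hs⟩ := hP (β * m - η)
        rw [tsum_eq_sum (s := s)]
        · refine (Finset.sum_le_card_nsmul s _ (‖u m‖ₑ ^ 2) fun j _ => ?_).trans ?_
          · split_ifs <;> simp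
          · rw [nsmul_eq_mul]
            gcongr
        · intro j hj
          rw [hs] at hj
          rw [if_neg]
          rwa [← sub_sub]
    _ = _ := by
        rw [ENNReal.tsum_mul_left]
        push_cast
        ring

end LowerBound

/-! ### The upper bound for sequences -/

section UpperBound

variable {ι : Type*} [Fintype ι] {a z : ι → ℂ} {β T : ℝ}

/-- Weighted Cauchy–Schwarz; the factor `2` is the price of the crude `x * y ≤ x ^ 2 + y ^ 2`. -/
theorem ENNReal.sq_tsum_mul_le {κ : Type*} (f g : κ → ENNReal) :
    (∑' i, f i * g i) ^ 2 ≤ 2 * (∑' i, f i ^ 2 * g i) * ∑' i, g i := by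
  have hle : ∀ x y : ENNReal, x * y ≤ x ^ 2 + y ^ 2 := by
    intro x y
    rcases le_total x y with h | h
    · calc x * y ≤ y * y := by gcongr
        _ = y ^ 2 := (sq y).symm
        _ ≤ _ := le_add_self
    · calc x * y ≤ x * x := by gcongr
        _ = x ^ 2 := (sq x).symm
        _ ≤ _ := le_self_add
  calc (∑' i, f i * g i) ^ 2 = ∑' i, ∑' j, (f i * g i) * (f j * g j) := by
        rw [sq, ← ENNReal.tsum_mul_right]
        simp only [ENNReal.tsum_mul_left]
    _ ≤ ∑' i, ∑' j, (f i ^ 2 * g i * g j + g i * (f j ^ 2 * g j)) := by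
        refine ENNReal.tsum_le_tsum fun i => ENNReal.tsum_le_tsum fun j => ?_
        calc (f i * g i) * (f j * g j) = (f i * f j) * (g i * g j) := by ring
          _ ≤ (f i ^ 2 + f j ^ 2) * (g i * g j) := by
            gcongr
            exact hle _ _
          _ = _ := by ring
    _ = _ := by
        simp only [ENNReal.tsum_add, ENNReal.tsum_mul_left, ENNReal.tsum_mul_right]
        ring

theorem enorm_expSum_add_le (hz : ∀ k, (z k).re < 0) {τ : ℝ} (hτ : 0 ≤ τ) (T : ℝ) (l : ℕ) :
    ‖expSum a z (τ + T * l)‖ₑ ≤ ∑ k, ‖a k‖ₑ * ‖Complex.exp (z k * T)‖ₑ ^ l := by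
  refine (enorm_sum_le _ _).trans (Finset.sum_le_sum fun k _ => ?_)
  have e : z k * ((τ + T * l : ℝ) : ℂ) = z k * τ + l * (z k * T) := by
    push_cast; ring
  have h1 : ‖Complex.exp (z k * τ)‖ₑ ≤ 1 := by
    rw [← ofReal_norm]
    exact ENNReal.ofReal_le_one.2 (norm_exp_mul_ofReal_le_one (hz k) hτ)
  rw [e, Complex.exp_add, Complex.exp_nat_mul, enorm_mul, enorm_mul, enorm_pow]
  gcongr
  exact mul_le_of_le_one_left zero_le h1

/-- The sums of a causal exponential sum over the translates of a lattice are bounded. -/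
theorem exists_tsum_causalExpSum_le (a : ι → ℂ) (hz : ∀ k, (z k).re < 0) (hT : 0 < T) :
    ∃ C : NNReal, ∀ x : ℝ, ∑' j : ℤ, ‖causalExpSum a z (x - T * j)‖ₑ ≤ C := by
  have hlt : ∀ k, ‖Complex.exp (z k * T)‖ₑ < 1 := by
    intro k
    rw [← ofReal_norm, ENNReal.ofReal_lt_one, Complex.norm_exp, Real.exp_lt_one_iff,
      Complex.re_mul_ofReal]
    exact mul_neg_of_neg_of_pos (hz k) hT
  have hfin : ∑ k, ‖a k‖ₑ * (1 - ‖Complex.exp (z k * T)‖ₑ)⁻¹ ≠ ⊤ := by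
    refine ENNReal.sum_ne_top.2 fun k _ => ENNReal.mul_ne_top enorm_ne_top ?_
    rw [ENNReal.inv_ne_top]
    exact (tsub_pos_of_lt (hlt k)).ne'
  refine ⟨(∑ k, ‖a k‖ₑ * (1 - ‖Complex.exp (z k * T)‖ₑ)⁻¹).toNNReal, fun x => ?_⟩
  rw [ENNReal.coe_toNNReal hfin]
  -- The last `j` with `T j` strictly before `x`; going back from it, the terms are dominated by
  -- geometric series.
  set j₀ := ⌈x / T⌉ - 1 with hj₀
  have h1 : 0 < x - T * j₀ := by
    have := Int.ceil_lt_add_one (x / T)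
    rw [← sub_lt_iff_lt_add, lt_div_iff₀ hT] at this
    rw [hj₀]
    push_cast
    linarith
  have h2 : x - T * j₀ ≤ T := by
    have := Int.le_ceil (x / T)
    rw [div_le_iff₀ hT] at this
    rw [hj₀]
    push_cast
    linarith
  rw [← (Equiv.subLeft j₀).tsum_eq,
    tsum_of_nat_of_neg_add_one ENNReal.summable ENNReal.summable]
  have hneg : ∀ n : ℕ, ‖causalExpSum a z
      (x - T * ((Equiv.subLeft j₀ (-((n : ℤ) + 1)) : ℤ) : ℝ))‖ₑ = 0 := by
    intro n
    rw [causalExpSum, if_neg, enorm_zero]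
    rw [Equiv.subLeft_apply]
    push_cast
    nlinarith [mul_nonneg hT.le (Nat.cast_nonneg (α := ℝ) n)]
  simp only [hneg, tsum_zero, add_zero]
  calc ∑' n : ℕ, ‖causalExpSum a z (x - T * ((Equiv.subLeft j₀ (n : ℤ) : ℤ) : ℝ))‖ₑ
      ≤ ∑' n : ℕ, ∑ k, ‖a k‖ₑ * ‖Complex.exp (z k * T)‖ₑ ^ n := by
        refine ENNReal.tsum_le_tsum fun n => ?_
        have e : x - T * ((Equiv.subLeft j₀ (n : ℤ) : ℤ) : ℝ) = (x - T * j₀) + T * n := by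
          rw [Equiv.subLeft_apply]
          push_cast
          ring
        rw [e, causalExpSum]
        split_ifs
        · exact enorm_expSum_add_le hz h1.le T n
        · simp
    _ = _ := by
        rw [Summable.tsum_finsetSum fun _ _ => ENNReal.summable]
        simp only [ENNReal.tsum_mul_left, ENNReal.tsum_geometric]

/-- Schur test: the kernel has uniformly bounded sums both over the nodes and over the samples. -/
theorem exists_tsum_nodeSamples_le (a : ι → ℂ) (hz : ∀ k, (z k).re < 0) (hβ : 0 < β) (hT : 0 < T) :
    ∃ C : NNReal, ∀ (c : ℤ → ℂ) (η : ℝ),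
      ∑' m : ℤ, (∑' j, ‖c j‖ₑ * ‖causalExpSum a z (β * m - (η + T * j))‖ₑ) ^ 2 ≤
        C * ∑' j, ‖c j‖ₑ ^ 2 := by
  obtain ⟨C₁, h₁⟩ := exists_tsum_causalExpSum_le a hz hT
  obtain ⟨C₂, h₂⟩ := exists_tsum_causalExpSum_le a hz hβ
  refine ⟨2 * C₁ * C₂, fun c η => ?_⟩
  have h₁' : ∀ m : ℤ, ∑' j : ℤ, ‖causalExpSum a z (β * m - (η + T * j))‖ₑ ≤ C₁ := by
    intro m
    simp only [← sub_sub]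
    exact h₁ _
  have h₂' : ∀ j : ℤ, ∑' m : ℤ, ‖causalExpSum a z (β * m - (η + T * j))‖ₑ ≤ C₂ := by
    intro j
    refine le_trans (le_of_eq ?_) (h₂ (-(η + T * j)))
    rw [← (Equiv.neg ℤ).tsum_eq]
    refine tsum_congr fun m => ?_
    rw [Equiv.neg_apply]
    congr 2
    push_cast
    ring
  calc ∑' m : ℤ, (∑' j, ‖c j‖ₑ * ‖causalExpSum a z (β * m - (η + T * j))‖ₑ) ^ 2
      ≤ ∑' m : ℤ, 2 * (∑' j, ‖c j‖ₑ ^ 2 * ‖causalExpSum a z (β * m - (η + T * j))‖ₑ) * C₁ := by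
        refine ENNReal.tsum_le_tsum fun m => (ENNReal.sq_tsum_mul_le _ _).trans ?_
        gcongr
        exact h₁' m
    _ = 2 * C₁ * ∑' j, ‖c j‖ₑ ^ 2 * ∑' m : ℤ, ‖causalExpSum a z (β * m - (η + T * j))‖ₑ := by
        rw [ENNReal.tsum_mul_right, ENNReal.tsum_mul_left, ENNReal.tsum_comm]
        simp only [ENNReal.tsum_mul_left]
        ring
    _ ≤ 2 * C₁ * ∑' j, ‖c j‖ₑ ^ 2 * C₂ := by
        gcongr with j
        exact h₂' j
    _ = _ := by
        rw [ENNReal.tsum_mul_right]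
        push_cast
        ring

end UpperBound

/-! ### Inverse Fourier integrals of one-sided exponentials -/

section ExponentialIntegrals

theorem norm_ofReal_mul_cexp_le {w : ℂ} (hw : w.re < 0) {x : ℝ} (hx : 0 ≤ x) :
    ‖(x : ℂ) * Complex.exp (w * x)‖ ≤ 2 / (-w.re) * Real.exp (w.re / 2 * x) := by
  have h1 : -w.re / 2 * x ≤ Real.exp (-w.re / 2 * x) := by
    linarith [Real.add_one_le_exp (-w.re / 2 * x)]
  have hpos : 0 < 2 / (-w.re) := by
    apply div_pos two_pos; linarith
  have h2 : x ≤ 2 / (-w.re) * Real.exp (-w.re / 2 * x) := by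
    rw [div_mul_eq_mul_div, le_div_iff₀ (by linarith)]
    linarith
  rw [norm_mul, Complex.norm_exp, Complex.re_mul_ofReal, Complex.norm_real, Real.norm_of_nonneg hx]
  calc x * Real.exp (w.re * x) ≤ 2 / (-w.re) * Real.exp (-w.re / 2 * x) * Real.exp (w.re * x) := by
        gcongr
    _ = _ := by
        rw [mul_assoc, ← Real.exp_add]
        congr 2
        ring

theorem integrableOn_ofReal_mul_cexp {w : ℂ} (hw : w.re < 0) :
    IntegrableOn (fun x : ℝ => (x : ℂ) * Complex.exp (w * x)) (Set.Ioi 0) := by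
  refine Integrable.mono' ((integrableOn_exp_mul_Ioi (a := w.re / 2) (by linarith) 0).const_mul
    (2 / (-w.re))) (by fun_prop) ?_
  filter_upwards [self_mem_ae_restrict measurableSet_Ioi] with x hx
  exact norm_ofReal_mul_cexp_le hw (le_of_lt hx)

theorem integral_ofReal_mul_cexp {w : ℂ} (hw : w.re < 0) :
    ∫ x : ℝ in Set.Ioi 0, (x : ℂ) * Complex.exp (w * x) = 1 / w ^ 2 := by
  have hw0 : w ≠ 0 := by
    rintro rfl
    simp at hw
  have hexp : Tendsto (fun x : ℝ => Real.exp (w.re / 2 * x)) atTop (𝓝 0) :=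
    Real.tendsto_exp_atBot.comp (tendsto_id.const_mul_atTop_of_neg (by linarith))
  have hexp' : Tendsto (fun x : ℝ => Complex.exp (w * x)) atTop (𝓝 0) := by
    rw [tendsto_zero_iff_norm_tendsto_zero]
    simp only [Complex.norm_exp, Complex.re_mul_ofReal]
    exact Real.tendsto_exp_atBot.comp (tendsto_id.const_mul_atTop_of_neg hw)
  have hxexp : Tendsto (fun x : ℝ => (x : ℂ) * Complex.exp (w * x)) atTop (𝓝 0) := by
    refine squeeze_zero_norm' ?_ (by simpa using hexp.const_mul (2 / (-w.re)))
    filter_upwards [eventually_ge_atTop 0] with x hx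
    exact norm_ofReal_mul_cexp_le hw hx
  have h := integral_Ioi_of_hasDerivAt_of_tendsto'
    (f := fun x : ℝ => w⁻¹ * ((x : ℂ) * Complex.exp (w * x)) - (w ^ 2)⁻¹ * Complex.exp (w * x))
    (f' := fun x : ℝ => (x : ℂ) * Complex.exp (w * x)) (a := 0) (m := 0) (fun x _ => ?_)
    (integrableOn_ofReal_mul_cexp hw) ?_
  · rw [h]
    simp
  · have h1 : HasDerivAt (fun x : ℝ => (x : ℂ)) 1 x := Complex.ofRealCLM.hasDerivAt
    have h2 : HasDerivAt (fun x : ℝ => Complex.exp (w * x)) (Complex.exp (w * x) * (w * 1)) x :=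
      (h1.const_mul w).cexp
    refine (((h1.mul h2).const_mul w⁻¹).sub (h2.const_mul (w ^ 2)⁻¹)).congr_deriv ?_
    field_simp
    ring
  · simpa using (hxexp.const_mul w⁻¹).sub (hexp'.const_mul (w ^ 2)⁻¹)

theorem fourierInv_causal_cexp {z : ℂ} (hz : z.re < 0) (t : ℝ) :
    𝓕⁻ (fun x : ℝ => if 0 < x then Complex.exp (z * x) else 0) t =
      -1 / (z + 2 * Real.pi * Complex.I * t) := by
  rw [Real.fourierInv_eq']
  have h1 : (fun x : ℝ => Complex.exp ((2 * Real.pi * inner ℝ x t : ℝ) * Complex.I) •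
      (if 0 < x then Complex.exp (z * x) else 0)) =
      (Set.Ioi (0 : ℝ)).indicator
        fun x : ℝ => Complex.exp ((z + 2 * Real.pi * Complex.I * t) * x) := by
    ext x
    rw [Set.indicator_apply]
    by_cases hx : 0 < x
    · rw [if_pos hx, if_pos (Set.mem_Ioi.2 hx), smul_eq_mul, ← Complex.exp_add]
      congr 1
      simp only [RCLike.inner_apply, conj_trivial]
      push_cast
      ring
    · rw [if_neg hx, if_neg (by simpa using hx), smul_zero]
  rw [h1, integral_indicator measurableSet_Ioi, integral_exp_mul_complex_Ioi]
  · simp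
  · simpa using hz

theorem fourierInv_ramp_mul_cexp {z : ℂ} (hz : z.re < 0) (t : ℝ) :
    𝓕⁻ (fun x : ℝ => ((max x 0 : ℝ) : ℂ) * Complex.exp (z * x)) t =
      1 / (z + 2 * Real.pi * Complex.I * t) ^ 2 := by
  rw [Real.fourierInv_eq']
  have h1 : (fun x : ℝ => Complex.exp ((2 * Real.pi * inner ℝ x t : ℝ) * Complex.I) •
      (((max x 0 : ℝ) : ℂ) * Complex.exp (z * x))) =
      (Set.Ioi (0 : ℝ)).indicator
        fun x : ℝ => (x : ℂ) * Complex.exp ((z + 2 * Real.pi * Complex.I * t) * x) := by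
    ext x
    rw [Set.indicator_apply]
    by_cases hx : 0 < x
    · rw [if_pos (Set.mem_Ioi.2 hx), smul_eq_mul, max_eq_left hx.le, mul_left_comm,
        ← Complex.exp_add]
      congr 2
      simp only [RCLike.inner_apply, conj_trivial]
      push_cast
      ring
    · rw [if_neg (by simpa using hx), max_eq_right (not_lt.1 hx)]
      simp
  rw [h1, integral_indicator measurableSet_Ioi, integral_ofReal_mul_cexp]
  simpa using hz

theorem integrable_ramp_mul_cexp {z : ℂ} (hz : z.re < 0) :
    Integrable fun x : ℝ => ((max x 0 : ℝ) : ℂ) * Complex.exp (z * x) := by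
  have h1 : (fun x : ℝ => ((max x 0 : ℝ) : ℂ) * Complex.exp (z * x)) =
      (Set.Ioi (0 : ℝ)).indicator fun x : ℝ => (x : ℂ) * Complex.exp (z * x) := by
    ext x
    rw [Set.indicator_apply]
    by_cases hx : 0 < x
    · rw [if_pos (Set.mem_Ioi.2 hx), max_eq_left hx.le]
    · rw [if_neg (by simpa using hx), max_eq_right (not_lt.1 hx)]
      simp
  rw [h1, integrable_indicator_iff measurableSet_Ioi]
  exact integrableOn_ofReal_mul_cexp hz

end ExponentialIntegrals

/-! ### The improper Fourier transform of the Cauchy kernel -/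

section CauchyKernel

variable {w : ℂ}

theorem ofReal_sub_I_mul_ne_zero (hw : w.re < 0) (t : ℝ) : (t : ℂ) - Complex.I * w ≠ 0 := by
  intro h
  have := congrArg Complex.im h
  simp at this
  linarith

theorem exists_normSq_cauchyKernel_le (hw : w.re < 0) :
    ∃ C : ℝ, ∀ t : ℝ, ‖((t : ℂ) - Complex.I * w)⁻¹‖ ^ 2 ≤ C * (1 + (t + w.im) ^ 2)⁻¹ := by
  refine ⟨1 + (w.re ^ 2)⁻¹, fun t => ?_⟩
  have h1 : ‖(t : ℂ) - Complex.I * w‖ ^ 2 = (t + w.im) ^ 2 + w.re ^ 2 := by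
    rw [← Complex.normSq_eq_norm_sq, Complex.normSq_apply]
    simp
    ring
  have hr : 0 < w.re ^ 2 := by nlinarith
  rw [norm_inv, inv_pow, h1, ← div_eq_mul_inv, inv_le_iff_one_le_mul₀ (by positivity),
    div_mul_eq_mul_div, le_div_iff₀ (by positivity)]
  have : (w.re ^ 2)⁻¹ * w.re ^ 2 = 1 := inv_mul_cancel₀ hr.ne'
  have h2 : 0 ≤ (w.re ^ 2)⁻¹ * (t + w.im) ^ 2 := by positivity
  nlinarith

theorem continuous_cauchyKernel (hw : w.re < 0) :
    Continuous fun t : ℝ => ((t : ℂ) - Complex.I * w)⁻¹ :=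
  Continuous.inv₀ (by fun_prop) (ofReal_sub_I_mul_ne_zero hw)

theorem integrable_norm_sq_cauchyKernel (hw : w.re < 0) :
    Integrable fun t : ℝ => ‖((t : ℂ) - Complex.I * w)⁻¹‖ ^ 2 := by
  obtain ⟨C, hC⟩ := exists_normSq_cauchyKernel_le hw
  refine Integrable.mono' ((integrable_inv_one_add_sq.comp_add_right w.im).const_mul C)
    ((continuous_cauchyKernel hw).norm.pow 2).aestronglyMeasurable (ae_of_all _ fun t => ?_)
  rw [Real.norm_of_nonneg (by positivity)]
  exact hC t

theorem memLp_cauchyKernel (hw : w.re < 0) :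
    MemLp (fun t : ℝ => ((t : ℂ) - Complex.I * w)⁻¹) 2 := by
  rw [memLp_two_iff_integrable_sq_norm (continuous_cauchyKernel hw).aestronglyMeasurable]
  exact integrable_norm_sq_cauchyKernel hw

theorem integrable_sq_cauchyKernel (hw : w.re < 0) :
    Integrable fun t : ℝ => ((t : ℂ) - Complex.I * w)⁻¹ ^ 2 := by
  refine (integrable_norm_sq_cauchyKernel hw).mono
    ((continuous_cauchyKernel hw).pow 2).aestronglyMeasurable (ae_of_all _ fun t => ?_)
  simp

theorem two_pi_mul_add (w : ℂ) (t : ℝ) :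
    2 * Real.pi * w + 2 * Real.pi * Complex.I * t =
      2 * Real.pi * Complex.I * ((t : ℂ) - Complex.I * w) := by
  linear_combination (2 * Real.pi * w) * Complex.I_mul_I

theorem re_two_pi_mul (hw : w.re < 0) : (2 * Real.pi * w).re < 0 := by
  have : (2 * Real.pi * w).re = 2 * Real.pi * w.re := by
    simp
  rw [this]
  exact mul_neg_of_pos_of_neg (by positivity) hw

/-- Fourier inversion for the ramp `max x 0 * exp (z * x)`, which is continuous with integrable
transform; the cut-off exponential jumps at `0` and would not qualify. -/
theorem integral_sq_cauchyKernel_mul_cexp (hw : w.re < 0) {ξ : ℝ} (hξ : 0 < ξ) :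
    ∫ t : ℝ, ((t : ℂ) - Complex.I * w)⁻¹ ^ 2 * Complex.exp (-(2 * Real.pi * Complex.I * t * ξ)) =
      (2 * Real.pi * Complex.I) ^ 2 * (ξ * Complex.exp (2 * Real.pi * w * ξ)) := by
  have hz := re_two_pi_mul hw
  set z := 2 * Real.pi * w with hzdef
  set p : ℝ → ℂ := fun x : ℝ => ((max x 0 : ℝ) : ℂ) * Complex.exp (z * x) with hp
  have hpi : (2 * Real.pi * Complex.I : ℂ) ≠ 0 := Complex.two_pi_I_ne_zero
  have hinv : 𝓕⁻ p = fun t : ℝ =>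
      ((2 * Real.pi * Complex.I) ^ 2)⁻¹ * ((t : ℂ) - Complex.I * w)⁻¹ ^ 2 := by
    ext t
    rw [hp, fourierInv_ramp_mul_cexp hz, hzdef, two_pi_mul_add, mul_pow, one_div, mul_inv, inv_pow]
  have hint : Integrable (𝓕⁻ p) := by
    rw [hinv]
    exact (integrable_sq_cauchyKernel hw).const_mul _
  have hint' : Integrable (𝓕 p) := by
    have : 𝓕 p = fun t => 𝓕⁻ p (-t) := by
      ext t
      rw [Real.fourierInv_eq_fourier_neg, neg_neg]
    rw [this]
    exact hint.comp_neg
  have hcont : Continuous p := by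
    simp only [hp]
    fun_prop
  have h := (integrable_ramp_mul_cexp hz).fourier_fourierInv_eq hint' (v := ξ) hcont.continuousAt
  change 𝓕 (𝓕⁻ p) ξ = _ at h
  rw [hinv, Real.fourier_real_eq_integral_exp_smul, max_eq_left hξ.le] at h
  rw [← h, ← integral_const_mul]
  congr 1
  ext t
  rw [smul_eq_mul, mul_comm (Complex.exp _), ← mul_assoc, ← mul_assoc,
    mul_inv_cancel₀ (pow_ne_zero 2 hpi), one_mul]
  congr 2
  push_cast
  ring

theorem tendsto_cauchyKernel (w : ℂ) {l : Filter ℝ} (hl : Tendsto (fun t : ℝ => |t|) l atTop) :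
    Tendsto (fun t : ℝ => ((t : ℂ) - Complex.I * w)⁻¹) l (𝓝 0) := by
  refine tendsto_inv₀_cobounded.comp (tendsto_norm_atTop_iff_cobounded.1 ?_)
  refine tendsto_atTop_mono (fun t => ?_) (tendsto_atTop_add_const_right l (-‖w‖) hl)
  have := norm_sub_norm_le (t : ℂ) (Complex.I * w)
  rw [norm_mul, Complex.norm_I, one_mul, Complex.norm_real, Real.norm_eq_abs] at this
  linarith

/-- Integration by parts trades the decay `1 / |t|` for the absolutely integrable `1 / t ^ 2`. -/
theorem integral_cauchyKernel_mul_cexp (hw : w.re < 0) {c : ℂ} (hc : c ≠ 0) (R : ℝ) :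
    ∫ t in (-R)..R, ((t : ℂ) - Complex.I * w)⁻¹ * Complex.exp (-(c * t)) =
      -c⁻¹ * ((((R : ℂ) - Complex.I * w)⁻¹ * Complex.exp (-(c * R)) -
        (((-R : ℝ) : ℂ) - Complex.I * w)⁻¹ * Complex.exp (-(c * (-R : ℝ)))) +
        ∫ t in (-R)..R, ((t : ℂ) - Complex.I * w)⁻¹ ^ 2 * Complex.exp (-(c * t))) := by
  have hcont := continuous_cauchyKernel hw
  have hcont1 : Continuous fun t : ℝ => ((t : ℂ) - Complex.I * w)⁻¹ * Complex.exp (-(c * t)) :=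
    hcont.mul (by fun_prop)
  have hcont2 : Continuous fun t : ℝ =>
      ((t : ℂ) - Complex.I * w)⁻¹ ^ 2 * Complex.exp (-(c * t)) :=
    (hcont.pow 2).mul (by fun_prop)
  have h := intervalIntegral.integral_eq_sub_of_hasDerivAt (a := -R) (b := R)
    (f := fun t : ℝ => ((t : ℂ) - Complex.I * w)⁻¹ * Complex.exp (-(c * t)))
    (f' := fun t : ℝ => -(((t : ℂ) - Complex.I * w)⁻¹ ^ 2 * Complex.exp (-(c * t))) -
      c * (((t : ℂ) - Complex.I * w)⁻¹ * Complex.exp (-(c * t)))) (fun t _ => ?_)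
    ((hcont2.neg.sub (continuous_const.mul hcont1)).intervalIntegrable _ _)
  · have h4 : Continuous fun t : ℝ =>
        -(((t : ℂ) - Complex.I * w)⁻¹ ^ 2 * Complex.exp (-(c * t))) := hcont2.neg
    have h5 : Continuous fun t : ℝ =>
        c * (((t : ℂ) - Complex.I * w)⁻¹ * Complex.exp (-(c * t))) := continuous_const.mul hcont1
    rw [← h, intervalIntegral.integral_sub (h4.intervalIntegrable _ _) (h5.intervalIntegrable _ _),
      intervalIntegral.integral_neg, intervalIntegral.integral_const_mul, neg_mul, ← mul_neg,
      eq_inv_mul_iff_mul_eq₀ hc]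
    ring
  · have h1 : HasDerivAt (fun t : ℝ => (t : ℂ)) 1 t := Complex.ofRealCLM.hasDerivAt
    have h2 := (h1.sub_const (Complex.I * w)).inv (ofReal_sub_I_mul_ne_zero hw t)
    have h3 := ((h1.const_mul c).neg).cexp
    refine (h2.mul h3).congr_deriv ?_
    have := ofReal_sub_I_mul_ne_zero hw t
    simp only [Pi.neg_apply, Pi.inv_apply]
    field_simp
    ring

theorem tendsto_integral_cauchyKernel (hw : w.re < 0) {ξ : ℝ} (hξ : 0 < ξ) :
    Tendsto (fun R : ℝ => ∫ t in (-R)..R,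
      ((t : ℂ) - Complex.I * w)⁻¹ * Complex.exp (-(2 * Real.pi * Complex.I * t * ξ))) atTop
      (𝓝 (-(2 * Real.pi * Complex.I) * Complex.exp (2 * Real.pi * w * ξ))) := by
  set c : ℂ := 2 * Real.pi * Complex.I * ξ with hc
  have hpi : (2 * Real.pi * Complex.I : ℂ) ≠ 0 := Complex.two_pi_I_ne_zero
  have hξ0 : (ξ : ℂ) ≠ 0 := Complex.ofReal_ne_zero.2 hξ.ne'
  have hc0 : c ≠ 0 := mul_ne_zero hpi hξ0
  have he : ∀ t : ℝ, (2 * Real.pi * Complex.I * t * ξ : ℂ) = c * t := fun t => by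
    rw [hc]; ring
  have hnorm : ∀ t : ℝ, ‖Complex.exp (-(c * t))‖ = 1 := by
    intro t
    have : -(c * t) = ((-(2 * Real.pi * ξ * t) : ℝ) : ℂ) * Complex.I := by
      rw [hc]; push_cast; ring
    rw [this, Complex.norm_exp_ofReal_mul_I]
  have hbd : ∀ {l : Filter ℝ}, Tendsto (fun t : ℝ => |t|) l atTop →
      Tendsto (fun t : ℝ => ((t : ℂ) - Complex.I * w)⁻¹ * Complex.exp (-(c * t))) l (𝓝 0) := by
    intro l hl
    rw [tendsto_zero_iff_norm_tendsto_zero]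
    simp only [norm_mul, hnorm, mul_one]
    exact tendsto_zero_iff_norm_tendsto_zero.1 (tendsto_cauchyKernel w hl)
  have hsq := integral_sq_cauchyKernel_mul_cexp hw hξ
  simp only [he] at hsq ⊢
  have hint : Integrable fun t : ℝ =>
      ((t : ℂ) - Complex.I * w)⁻¹ ^ 2 * Complex.exp (-(c * t)) := by
    refine (integrable_sq_cauchyKernel hw).mono (Continuous.aestronglyMeasurable
      (((continuous_cauchyKernel hw).pow 2).mul (by fun_prop))) (ae_of_all _ fun t => ?_)
    rw [norm_mul, hnorm, mul_one]
  have hlim := intervalIntegral_tendsto_integral hint tendsto_neg_atTop_atBot tendsto_id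
  simp only [id] at hlim
  rw [hsq] at hlim
  have h1 := hbd tendsto_abs_atTop_atTop
  have h2 := (hbd tendsto_abs_atBot_atTop).comp tendsto_neg_atTop_atBot
  have h3 := ((h1.sub h2).add hlim).const_mul (-c⁻¹)
  have e : -c⁻¹ * (0 - 0 + (2 * Real.pi * Complex.I) ^ 2 *
      (ξ * Complex.exp (2 * Real.pi * w * ξ))) =
      -(2 * Real.pi * Complex.I) * Complex.exp (2 * Real.pi * w * ξ) := by
    rw [hc]
    field_simp
    ring
  rw [e] at h3
  exact h3.congr fun R => (integral_cauchyKernel_mul_cexp hw hc0 R).symm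

end CauchyKernel

/-! ### The Fourier transform of the window -/

section RationalWindow

variable {N : ℕ} {a w : Fin N → ℂ}

theorem fourierImproper_rationalWindow (hw : ∀ k, (w k).re < 0) {ξ : ℝ} (hξ : 0 < ξ) :
    fourierImproper (rationalWindow a w) ξ =
      -(2 * Real.pi * Complex.I) * expSum a (fun k => 2 * Real.pi * w k) ξ := by
  have h : ∀ R : ℝ, ∫ t in (-R)..R,
      rationalWindow a w t * Complex.exp (-(2 * Real.pi * Complex.I * t * ξ)) =
      ∑ k, a k * ∫ t in (-R)..R,
        ((t : ℂ) - Complex.I * w k)⁻¹ * Complex.exp (-(2 * Real.pi * Complex.I * t * ξ)) := by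
    intro R
    simp only [← intervalIntegral.integral_const_mul]
    rw [← intervalIntegral.integral_finsetSum]
    · congr 1
      ext t
      rw [rationalWindow, Finset.sum_mul]
      exact Finset.sum_congr rfl fun k _ => by rw [div_eq_mul_inv, mul_assoc]
    · intro k _
      refine Continuous.intervalIntegrable ?_ _ _
      exact continuous_const.mul ((continuous_cauchyKernel (hw k)).mul (by fun_prop))
  refine Tendsto.limUnder_eq ?_
  simp only [h]
  have := tendsto_finsetSum Finset.univ fun k _ =>
    (tendsto_integral_cauchyKernel (hw k) hξ).const_mul (a k)
  convert this using 2
  rw [expSum, Finset.mul_sum]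
  exact Finset.sum_congr rfl fun k _ => by ring

theorem memLp_rationalWindow (a : Fin N → ℂ) (hw : ∀ k, (w k).re < 0) :
    MemLp (rationalWindow a w) 2 := by
  have : rationalWindow a w = fun t : ℝ => ∑ k, a k * ((t : ℂ) - Complex.I * w k)⁻¹ := by
    ext t
    simp only [rationalWindow, div_eq_mul_inv]
  rw [this]
  exact memLp_finsetSum _ fun k _ => (memLp_cauchyKernel (hw k)).const_mul (a k)

end RationalWindow

/-! ### Periodization and Parseval -/

section Periodization

variable {T : ℝ}

theorem lintegral_eq_tsum_translates (hT : 0 < T) (f : ℝ → ENNReal) :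
    ∫⁻ x, f x = ∑' j : ℤ, ∫⁻ x in Set.Ioc 0 T, f (x - T * j) := by
  have h := (isAddFundamentalDomain_Ioc hT 0).lintegral_eq_tsum' f
  rw [zero_add] at h
  rw [h]
  let e : ℤ ≃ AddSubgroup.zmultiples T :=
    Equiv.ofBijective (fun n : ℤ => ⟨n • T, n, rfl⟩)
      ⟨fun m n hmn => (zsmul_left_strictMono hT).injective (congrArg Subtype.val hmn),
        fun ⟨x, n, hn⟩ => ⟨n, Subtype.ext hn⟩⟩
  rw [← e.tsum_eq]
  refine tsum_congr fun j => lintegral_congr fun x => ?_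
  congr 1
  simp only [e, Equiv.ofBijective_apply, AddSubgroup.vadd_def, AddSubgroup.coe_neg, vadd_eq_add,
    zsmul_eq_mul]
  ring

theorem integral_eq_tsum_translates (hT : 0 < T) {f : ℝ → ℂ} (hf : Integrable f) :
    ∫ x, f x = ∑' j : ℤ, ∫ x in Set.Ioc 0 T, f (x - T * j) := by
  have h := (isAddFundamentalDomain_Ioc hT 0).integral_eq_tsum' f hf
  rw [zero_add] at h
  rw [h]
  let e : ℤ ≃ AddSubgroup.zmultiples T :=
    Equiv.ofBijective (fun n : ℤ => ⟨n • T, n, rfl⟩)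
      ⟨fun m n hmn => (zsmul_left_strictMono hT).injective (congrArg Subtype.val hmn),
        fun ⟨x, n, hn⟩ => ⟨n, Subtype.ext hn⟩⟩
  rw [← e.tsum_eq]
  refine tsum_congr fun j => integral_congr_ae (ae_of_all _ fun x => ?_)
  simp only [e, Equiv.ofBijective_apply, AddSubgroup.vadd_def, AddSubgroup.coe_neg, vadd_eq_add,
    zsmul_eq_mul]
  congr 1
  ring

theorem lintegral_tsum_translates_enorm (hT : 0 < T) {f : ℝ → ℂ} (hf : AEStronglyMeasurable f) :
    ∫⁻ x in Set.Ioc 0 T, ∑' j : ℤ, ‖f (x - T * j)‖ₑ = ∫⁻ x, ‖f x‖ₑ := by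
  rw [lintegral_eq_tsum_translates hT, lintegral_tsum]
  intro j
  exact ((hf.comp_quasiMeasurePreserving
    (measurePreserving_sub_right volume (T * j)).quasiMeasurePreserving).enorm).restrict

theorem ae_summable_translates (hT : 0 < T) {f : ℝ → ℂ} (hf : Integrable f) :
    ∀ᵐ x ∂volume.restrict (Set.Ioc 0 T), Summable fun j : ℤ => f (x - T * j) := by
  have hmeas : AEMeasurable (fun x => ∑' j : ℤ, ‖f (x - T * j)‖ₑ)
      (volume.restrict (Set.Ioc 0 T)) := by
    refine AEMeasurable.tsum fun j => ?_
    exact ((hf.1.comp_quasiMeasurePreserving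
      (measurePreserving_sub_right volume (T * j)).quasiMeasurePreserving).enorm).restrict
  have hfin : ∫⁻ x in Set.Ioc 0 T, ∑' j : ℤ, ‖f (x - T * j)‖ₑ ≠ ⊤ := by
    rw [lintegral_tsum_translates_enorm hT hf.1]
    exact hf.2.ne
  filter_upwards [ae_lt_top' hmeas hfin] with x hx
  exact Summable.of_enorm hx.ne

theorem aestronglyMeasurable_tsum_translates (hT : 0 < T) {f : ℝ → ℂ} (hf : Integrable f) :
    AEStronglyMeasurable (fun x => ∑' j : ℤ, f (x - T * j)) (volume.restrict (Set.Ioc 0 T)) := by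
  refine aestronglyMeasurable_of_tendsto_ae (u := (atTop : Filter (Finset ℤ)))
    (f := fun s x => ∑ j ∈ s, f (x - T * j)) (fun s => ?_) ?_
  · refine Finset.aestronglyMeasurable_fun_sum s fun j _ => ?_
    exact (hf.1.comp_quasiMeasurePreserving
      (measurePreserving_sub_right volume (T * j)).quasiMeasurePreserving).restrict
  · filter_upwards [ae_summable_translates hT hf] with x hx
    exact hx.hasSum

theorem integral_tsum_translates (hT : 0 < T) {f : ℝ → ℂ} (hf : Integrable f) :
    ∫ x in Set.Ioc 0 T, ∑' j : ℤ, f (x - T * j) = ∫ x, f x := by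
  rw [integral_eq_tsum_translates hT hf, integral_tsum]
  · intro j
    exact (hf.1.comp_quasiMeasurePreserving
      (measurePreserving_sub_right volume (T * j)).quasiMeasurePreserving).restrict
  · rw [← lintegral_eq_tsum_translates hT fun x => ‖f x‖ₑ]
    exact hf.2.ne

/-- The exponentials are `T`-periodic, so the integrals are `T` times Fourier coefficients of the
periodization, which `hP` puts in `L²`; Parseval applies. -/
theorem tsum_sq_integral_mul_cexp (hT : 0 < T) {f : ℝ → ℂ} (hf : Integrable f)
    (hP : ∫⁻ x in Set.Ioc 0 T, ‖∑' j : ℤ, f (x - T * j)‖ₑ ^ 2 ≠ ⊤) :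
    ∑' m : ℤ, ‖∫ x, f x * Complex.exp (2 * Real.pi * Complex.I * m * x / T)‖ₑ ^ 2 =
      ENNReal.ofReal T * ∫⁻ x in Set.Ioc 0 T, ‖∑' j : ℤ, f (x - T * j)‖ₑ ^ 2 := by
  have hT0 : (T : ℂ) ≠ 0 := Complex.ofReal_ne_zero.2 hT.ne'
  set P : ℝ → ℂ := fun x => ∑' j : ℤ, f (x - T * j) with hPdef
  have hPm : MemLp P 2 (volume.restrict (Set.Ioc 0 T)) := by
    refine ⟨aestronglyMeasurable_tsum_translates hT hf, ?_⟩
    rw [eLpNorm_lt_top_iff_lintegral_rpow_enorm_lt_top two_ne_zero ENNReal.ofNat_ne_top]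
    simpa using hP.lt_top
  have hcoef : ∀ m : ℤ, ∫ x, f x * Complex.exp (2 * Real.pi * Complex.I * m * x / T) =
      T * fourierCoeffOn hT P (-m) := by
    intro m
    set E : ℝ → ℂ := fun x => Complex.exp (2 * Real.pi * Complex.I * m * x / T) with hE
    have hEcont : Continuous E := by
      simp only [hE]
      fun_prop
    have hEnorm : ∀ x, ‖E x‖ = 1 := by
      intro x
      have : (2 * Real.pi * Complex.I * m * x / T : ℂ) =
          ((2 * Real.pi * m * x / T : ℝ) : ℂ) * Complex.I := by
        push_cast; ring
      simp only [hE]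
      rw [this, Complex.norm_exp_ofReal_mul_I]
    have hfE : Integrable fun x => f x * E x :=
      hf.mul_bdd (c := 1) hEcont.aestronglyMeasurable (ae_of_all _ fun x => (hEnorm x).le)
    have hper : ∀ (x : ℝ) (j : ℤ), E (x - T * j) = E x := by
      intro x j
      simp only [hE]
      rw [Complex.exp_eq_exp_iff_exists_int]
      refine ⟨-(m * j), ?_⟩
      push_cast
      field_simp
      ring
    rw [← integral_tsum_translates hT hfE, fourierCoeffOn_eq_integral,
      intervalIntegral.integral_of_le hT.le]
    simp only [hper, tsum_mul_right, neg_neg, sub_zero]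
    rw [Complex.real_smul, ← mul_assoc]
    have e : (T : ℂ) * ((1 / T : ℝ) : ℂ) = 1 := by
      push_cast
      field_simp
    rw [e, one_mul]
    refine integral_congr_ae (ae_of_all _ fun x => ?_)
    simp only [fourier_coe_apply, sub_zero, smul_eq_mul]
    rw [mul_comm]
  have hpars := hasSum_sq_fourierCoeffOn hT hPm
  rw [← (Equiv.neg ℤ).hasSum_iff] at hpars
  have hpars' : HasSum (fun m : ℤ => T ^ 2 * ‖fourierCoeffOn hT P (-m)‖ ^ 2) _ :=
    hpars.mul_left (T ^ 2)
  rw [intervalIntegral.integral_of_le hT.le, sub_zero, smul_eq_mul] at hpars'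
  have hint : ENNReal.ofReal (∫ x in Set.Ioc 0 T, ‖P x‖ ^ 2) =
      ∫⁻ x in Set.Ioc 0 T, ‖P x‖ₑ ^ 2 := by
    rw [ofReal_integral_eq_lintegral_ofReal hPm.integrable_norm_pow'
      (ae_of_all _ fun x => by positivity)]
    refine lintegral_congr fun x => ?_
    rw [ENNReal.ofReal_pow (norm_nonneg _), ofReal_norm]
  calc ∑' m : ℤ, ‖∫ x, f x * Complex.exp (2 * Real.pi * Complex.I * m * x / T)‖ₑ ^ 2
      = ∑' m : ℤ, ENNReal.ofReal (T ^ 2 * ‖fourierCoeffOn hT P (-m)‖ ^ 2) := by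
        refine tsum_congr fun m => ?_
        rw [hcoef, ← ofReal_norm, ← ENNReal.ofReal_pow (norm_nonneg _), norm_mul, mul_pow,
          Complex.norm_real, Real.norm_of_nonneg hT.le]
    _ = ENNReal.ofReal (T ^ 2 * (T⁻¹ * ∫ x in Set.Ioc 0 T, ‖P x‖ ^ 2)) := by
        rw [← hpars'.tsum_eq, ENNReal.ofReal_tsum_of_nonneg (fun m => by positivity)
          hpars'.summable]
    _ = _ := by
        rw [← hint, ← ENNReal.ofReal_mul hT.le]
        congr 1
        field_simp

end Periodization

/-! ### Fourier transform on `L²` versus Fourier integrals -/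

section FourierInverse

/-- The Fourier transform on `L²` inverts the inverse Fourier integral of an integrable, square
integrable function. -/
theorem fourier_toLp_fourierInv {f : ℝ → ℂ} (hf : Integrable f) (hf2 : MemLp f 2) {φ : ℝ → ℂ}
    (hφ : 𝓕⁻ f = φ) (hφ2 : MemLp φ 2) :
    𝓕 (hφ2.toLp φ) = hf2.toLp f := by
  have hinv : 𝓕⁻ (hf2.toLp f) = hφ2.toLp φ := by
    -- `L²` embeds injectively in the tempered distributions, where the claim is that the inverse
    -- transform moves from the Schwartz function to `f` under the integral.
    have hker := Lp.ker_toTemperedDistributionCLM_eq_bot (E := ℝ) (F := ℂ) (μ := volume) (p := 2)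
    rw [LinearMap.ker_eq_bot] at hker
    apply hker
    change Lp.toTemperedDistribution (𝓕⁻ (hf2.toLp f)) = Lp.toTemperedDistribution (hφ2.toLp φ)
    rw [← Lp.fourierInv_toTemperedDistribution_eq]
    ext g
    rw [TemperedDistribution.fourierInv_apply, Lp.toTemperedDistribution_apply,
      Lp.toTemperedDistribution_apply]
    have h1 : ∫ x, (𝓕⁻ g) x • (hf2.toLp f) x = ∫ x, 𝓕⁻ (g : ℝ → ℂ) x • f x := by
      refine integral_congr_ae ?_
      filter_upwards [hf2.coeFn_toLp] with x hx
      rw [hx, SchwartzMap.fourierInv_coe]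
    have h2 : ∫ x, g x • (hφ2.toLp φ) x = ∫ x, g x • 𝓕⁻ f x := by
      refine integral_congr_ae ?_
      filter_upwards [hφ2.coeFn_toLp] with x hx
      rw [hx, hφ]
    rw [h1, h2]
    have := VectorFourier.integral_fourierIntegral_smul_eq_flip (μ := (volume : Measure ℝ))
      (ν := (volume : Measure ℝ)) (e := Real.fourierChar) (L := -innerₗ ℝ)
      Real.continuous_fourierChar (by
        simp only [LinearMap.neg_apply, innerₗ_apply_apply]
        fun_prop) g.integrable hf
    have hflip : (-innerₗ ℝ).flip = -innerₗ ℝ := by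
      ext
      simp
    rw [hflip] at this
    exact this
  rw [← hinv]
  exact fourier_fourierInv_eq _

end FourierInverse

/-! ### Integrability and inverse transform of causal exponential sums -/

section CausalExpSum

variable {ι : Type*} [Fintype ι] {a z : ι → ℂ}

theorem causalExpSum_eq_sum (a z : ι → ℂ) (x : ℝ) :
    causalExpSum a z x = ∑ k, a k * if 0 < x then Complex.exp (z k * x) else 0 := by
  rw [causalExpSum]
  split_ifs
  · rfl
  · simp

theorem integrable_causal_cexp {w : ℂ} (hw : w.re < 0) :
    Integrable fun x : ℝ => if 0 < x then Complex.exp (w * x) else 0 := by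
  have h1 : (fun x : ℝ => if 0 < x then Complex.exp (w * x) else 0) =
      (Set.Ioi (0 : ℝ)).indicator fun x : ℝ => Complex.exp (w * x) := by
    ext x
    rw [Set.indicator_apply]
    rfl
  rw [h1, integrable_indicator_iff measurableSet_Ioi]
  exact integrableOn_exp_mul_complex_Ioi hw 0

theorem memLp_causal_cexp {w : ℂ} (hw : w.re < 0) :
    MemLp (fun x : ℝ => if 0 < x then Complex.exp (w * x) else 0) 2 := by
  rw [memLp_two_iff_integrable_sq_norm (integrable_causal_cexp hw).1]
  have h2 : (2 * w).re < 0 := by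
    simp only [Complex.mul_re, Complex.re_ofNat, Complex.im_ofNat, zero_mul, sub_zero]
    linarith
  refine (integrable_causal_cexp h2).norm.congr (ae_of_all _ fun x => ?_)
  simp only
  split_ifs
  · rw [← norm_pow, ← Complex.exp_nat_mul]
    congr 2
    push_cast
    ring
  · simp

theorem integrable_causalExpSum (a : ι → ℂ) (hz : ∀ k, (z k).re < 0) :
    Integrable (causalExpSum a z) := by
  rw [funext (causalExpSum_eq_sum a z)]
  exact integrable_finsetSum _ fun k _ => (integrable_causal_cexp (hz k)).const_mul (a k)

theorem memLp_causalExpSum (a : ι → ℂ) (hz : ∀ k, (z k).re < 0) :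
    MemLp (causalExpSum a z) 2 := by
  rw [funext (causalExpSum_eq_sum a z)]
  exact memLp_finsetSum _ fun k _ => (memLp_causal_cexp (hz k)).const_mul (a k)

theorem fourierInv_causalExpSum (a : ι → ℂ) (hz : ∀ k, (z k).re < 0) (t : ℝ) :
    𝓕⁻ (causalExpSum a z) t = ∑ k, a k * (-1 / (z k + 2 * Real.pi * Complex.I * t)) := by
  simp only [← fourierInv_causal_cexp (hz _)]
  simp only [Real.fourierInv_eq', smul_eq_mul, ← integral_const_mul]
  rw [← integral_finsetSum]
  · congr 1
    ext x
    rw [causalExpSum_eq_sum, Finset.mul_sum]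
    exact Finset.sum_congr rfl fun k _ => by ring
  · intro k _
    refine Integrable.const_mul ?_ _
    refine (integrable_causal_cexp (hz k)).bdd_mul (c := 1)
      (Continuous.aestronglyMeasurable (by fun_prop)) (ae_of_all _ fun x => ?_)
    rw [Complex.norm_exp_ofReal_mul_I]

end CausalExpSum

/-! ### Gabor coefficients on the frequency side -/

section TimeFrequencyShifts

/-- The Fourier transform of `timeFreqShift x y (𝓕⁻ ψ)`. -/
noncomputable def shiftedSpectrum (x y : ℝ) (ψ : ℝ → ℂ) (ξ : ℝ) : ℂ :=
  ψ (ξ - y) * Complex.exp (((-(2 * Real.pi * x * (ξ - y)) : ℝ) : ℂ) * Complex.I)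

theorem fourierInv_shiftedSpectrum (x y : ℝ) (ψ : ℝ → ℂ) :
    𝓕⁻ (shiftedSpectrum x y ψ) = timeFreqShift x y (𝓕⁻ ψ) := by
  ext t
  rw [timeFreqShift, Real.fourierInv_eq', Real.fourierInv_eq', ← integral_const_mul,
    ← integral_add_right_eq_self _ y]
  congr 1
  ext ξ
  simp only [shiftedSpectrum, add_sub_cancel_right, smul_eq_mul, RCLike.inner_apply, conj_trivial]
  rw [mul_left_comm, ← Complex.exp_add, ← mul_assoc (Complex.exp _) (Complex.exp _) (ψ ξ),
    ← Complex.exp_add, mul_comm]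
  congr 2
  push_cast
  ring

theorem integrable_shiftedSpectrum (x y : ℝ) {ψ : ℝ → ℂ} (hψ : Integrable ψ) :
    Integrable (shiftedSpectrum x y ψ) := by
  refine (hψ.comp_sub_right y).mul_bdd (c := 1)
    (Continuous.aestronglyMeasurable (by fun_prop)) (ae_of_all _ fun ξ => ?_)
  rw [Complex.norm_exp_ofReal_mul_I]

theorem memLp_shiftedSpectrum (x y : ℝ) {ψ : ℝ → ℂ} (hψ : MemLp ψ 2) :
    MemLp (shiftedSpectrum x y ψ) 2 := by
  have h1 : MemLp (fun ξ => ψ (ξ - y)) 2 :=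
    hψ.comp_measurePreserving (measurePreserving_sub_right volume y)
  refine MemLp.of_le h1 (h1.1.mul (Continuous.aestronglyMeasurable (by fun_prop)))
    (ae_of_all _ fun ξ => ?_)
  rw [shiftedSpectrum, norm_mul, Complex.norm_exp_ofReal_mul_I, mul_one]

theorem memLp_timeFreqShift (x y : ℝ) {g : ℝ → ℂ} (hg : MemLp g 2) :
    MemLp (timeFreqShift x y g) 2 := by
  have h1 : MemLp (fun t => g (t - x)) 2 :=
    hg.comp_measurePreserving (measurePreserving_sub_right volume x)
  refine MemLp.of_le h1 ((Continuous.aestronglyMeasurable (by fun_prop)).mul h1.1)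
    (ae_of_all _ fun t => ?_)
  have : (2 * Real.pi * Complex.I * y * t : ℂ) =
      ((2 * Real.pi * y * t : ℝ) : ℂ) * Complex.I := by
    push_cast; ring
  rw [timeFreqShift, norm_mul, this, Complex.norm_exp_ofReal_mul_I, one_mul]

theorem enorm_inner_timeFreqShift {ψ : ℝ → ℂ} (hψ : Integrable ψ) (hψ2 : MemLp ψ 2)
    (f : Lp ℂ 2 (volume : Measure ℝ)) (x y : ℝ) (h : MemLp (timeFreqShift x y (𝓕⁻ ψ)) 2) :
    ‖inner ℂ f (h.toLp _)‖ₑ =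
      ‖∫ ξ, (𝓕 f : Lp ℂ 2 (volume : Measure ℝ)) ξ * conj (ψ (ξ - y)) *
        Complex.exp (2 * Real.pi * Complex.I * x * ξ)‖ₑ := by
  rw [← Lp.inner_fourier_eq, fourier_toLp_fourierInv (integrable_shiftedSpectrum x y hψ)
    (memLp_shiftedSpectrum x y hψ2) (fourierInv_shiftedSpectrum x y ψ) h, L2.inner_def]
  set F := (𝓕 f : Lp ℂ 2 (volume : Measure ℝ))
  have h1 : ∫ ξ, inner ℂ (F ξ) ((memLp_shiftedSpectrum x y hψ2).toLp _ ξ) =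
      ∫ ξ, Complex.exp (2 * Real.pi * Complex.I * x * y) * conj (F ξ * conj (ψ (ξ - y)) *
        Complex.exp (2 * Real.pi * Complex.I * x * ξ)) := by
    refine integral_congr_ae ?_
    filter_upwards [(memLp_shiftedSpectrum x y hψ2).coeFn_toLp] with ξ hξ
    rw [hξ, RCLike.inner_apply, shiftedSpectrum, map_mul, map_mul, Complex.conj_conj,
      ← Complex.exp_conj]
    simp only [map_mul, Complex.conj_ofReal, Complex.conj_I, map_ofNat]
    rw [mul_left_comm (Complex.exp _), ← Complex.exp_add, mul_comm (ψ _), mul_assoc, mul_comm,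
      mul_comm (conj (F ξ))]
    congr 2
    push_cast
    ring
  rw [h1, integral_const_mul, integral_conj, enorm_mul, RCLike.enorm_conj]
  have h2 : ‖Complex.exp (2 * Real.pi * Complex.I * x * y)‖ₑ = 1 := by
    have : (2 * Real.pi * Complex.I * x * y : ℂ) =
        ((2 * Real.pi * x * y : ℝ) : ℂ) * Complex.I := by
      push_cast; ring
    rw [this, ← ofReal_norm, Complex.norm_exp_ofReal_mul_I, ENNReal.ofReal_one]
  rw [h2, one_mul]

end TimeFrequencyShifts

/-! ### Reduction to sequences on the fibres -/

section FrequencySide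

variable {ι : Type*} [Fintype ι] {a z : ι → ℂ} {β T : ℝ}

theorem enorm_tsum_translates_mul_conj (F : ℝ → ℂ) (x : ℝ) (n : ℤ) :
    ‖∑' j : ℤ, F (x - T * j) * conj (causalExpSum a z (x - T * j + β * n))‖ₑ =
      ‖nodeSamples a z β T (-x) (fun j => conj (F (x - T * j))) n‖ₑ := by
  rw [← RCLike.enorm_conj, Complex.conj_tsum, nodeSamples]
  congr 2
  ext j
  rw [map_mul, Complex.conj_conj]
  congr 2
  ring

/-- Parseval in `m` gives `T` times an integral over `x` in `(0, T]`. Its integrand is the `ℓ²` norm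
squared of `nodeSamples` with `η = -x` and `c j = conj (F (x - T * j))`, so the sequence bounds
apply for almost every `x`, with constants independent of `x`. -/
theorem exists_frequency_side_bounds (hz : ∀ k, (z k).re < 0)
    (hz' : Function.Injective fun k => (z k).re) (hβ : 0 < β) (hβT : β < T)
    (hirr : Irrational (β / T)) (hH : ∀ τ : ℝ, 0 < τ → expSum a z τ ≠ 0) :
    ∃ C D : NNReal, ∀ F : ℝ → ℂ, MemLp F 2 →
      ∫⁻ ξ, ‖F ξ‖ₑ ^ 2 ≤ C * ∑' (n : ℤ) (m : ℤ), ‖∫ ξ, F ξ * conj (causalExpSum a z (ξ + β * n)) *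
        Complex.exp (2 * Real.pi * Complex.I * m * ξ / T)‖ₑ ^ 2 ∧
      ∑' (n : ℤ) (m : ℤ), ‖∫ ξ, F ξ * conj (causalExpSum a z (ξ + β * n)) *
        Complex.exp (2 * Real.pi * Complex.I * m * ξ / T)‖ₑ ^ 2 ≤ D * ∫⁻ ξ, ‖F ξ‖ₑ ^ 2 := by
  have hT : 0 < T := hβ.trans hβT
  obtain ⟨C, hC⟩ := exists_tsum_coeff_le hz hz' hβ hβT hirr hH
  obtain ⟨D, hD⟩ := exists_tsum_nodeSamples_le a hz hβ hT
  lift T to NNReal using hT.le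
  have hT0 : T ≠ 0 := by
    rintro rfl
    simp at hT
  refine ⟨C * T⁻¹, T * D, fun F hF => ?_⟩
  have hG : ∀ n : ℤ, Integrable fun ξ => F ξ * conj (causalExpSum a z (ξ + β * n)) := by
    intro n
    have h1 : MemLp (fun ξ => causalExpSum a z (ξ + β * n)) 2 :=
      (memLp_causalExpSum a hz).comp_measurePreserving (measurePreserving_add_right volume (β * n))
    exact hF.integrable_mul h1.star
  have hFmeas : AEMeasurable (fun x => ∑' j : ℤ, ‖F (x - T * j)‖ₑ ^ 2)
      (volume.restrict (Set.Ioc 0 (T : ℝ))) := by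
    refine AEMeasurable.tsum fun j => ?_
    exact (((hF.1.comp_quasiMeasurePreserving
      (measurePreserving_sub_right volume ((T : ℝ) * j)).quasiMeasurePreserving).enorm).pow_const
      2).restrict
  have hFint : ∫⁻ x in Set.Ioc 0 (T : ℝ), ∑' j : ℤ, ‖F (x - T * j)‖ₑ ^ 2 = ∫⁻ ξ, ‖F ξ‖ₑ ^ 2 := by
    rw [lintegral_eq_tsum_translates hT, lintegral_tsum]
    intro j
    exact (((hF.1.comp_quasiMeasurePreserving
      (measurePreserving_sub_right volume ((T : ℝ) * j)).quasiMeasurePreserving).enorm).pow_const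
      2).restrict
  have hFfin : ∫⁻ ξ, ‖F ξ‖ₑ ^ 2 ≠ ⊤ := by
    have := hF.2
    rw [eLpNorm_lt_top_iff_lintegral_rpow_enorm_lt_top two_ne_zero ENNReal.ofNat_ne_top] at this
    simpa using this.ne
  have hupper : ∀ x : ℝ, ∑' n : ℤ, ‖∑' j : ℤ, F (x - T * j) *
      conj (causalExpSum a z (x - T * j + β * n))‖ₑ ^ 2 ≤ D * ∑' j : ℤ, ‖F (x - T * j)‖ₑ ^ 2 := by
    intro x
    refine le_trans (ENNReal.tsum_le_tsum fun n => ?_)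
      ((hD (fun j => conj (F (x - T * j))) (-x)).trans (le_of_eq ?_))
    · rw [enorm_tsum_translates_mul_conj]
      gcongr
      refine enorm_tsum_le_tsum_enorm.trans (le_of_eq (tsum_congr fun j => ?_))
      rw [enorm_mul]
    · simp only [RCLike.enorm_conj]
  have hsum : ∑' (n : ℤ) (m : ℤ), ‖∫ ξ, F ξ * conj (causalExpSum a z (ξ + β * n)) *
      Complex.exp (2 * Real.pi * Complex.I * m * ξ / (T : ℝ))‖ₑ ^ 2 =
      T * ∫⁻ x in Set.Ioc 0 (T : ℝ), ∑' n : ℤ, ‖∑' j : ℤ, F (x - T * j) *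
        conj (causalExpSum a z (x - T * j + β * n))‖ₑ ^ 2 := by
    rw [lintegral_tsum fun n => ((aestronglyMeasurable_tsum_translates hT (hG n)).enorm.pow_const
      2), ← ENNReal.tsum_mul_left]
    refine tsum_congr fun n => ?_
    rw [tsum_sq_integral_mul_cexp hT (hG n), ENNReal.ofReal_coe_nnreal]
    refine ne_top_of_le_ne_top (ENNReal.mul_ne_top (ENNReal.coe_ne_top (r := D)) hFfin) ?_
    rw [← hFint, ← lintegral_const_mul'' _ hFmeas]
    exact lintegral_mono fun x => (ENNReal.le_tsum n).trans (hupper x)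
  rw [hsum]
  constructor
  · have hTinv : ((C * T⁻¹ : NNReal) : ENNReal) * (T * ∫⁻ x in Set.Ioc 0 (T : ℝ),
        ∑' n : ℤ, ‖∑' j : ℤ, F (x - T * j) *
          conj (causalExpSum a z (x - T * j + β * n))‖ₑ ^ 2) =
        C * ∫⁻ x in Set.Ioc 0 (T : ℝ), ∑' n : ℤ, ‖∑' j : ℤ, F (x - T * j) *
          conj (causalExpSum a z (x - T * j + β * n))‖ₑ ^ 2 := by
      rw [← mul_assoc, ← ENNReal.coe_mul, mul_assoc, inv_mul_cancel₀ hT0, mul_one]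
    rw [hTinv, ← hFint, ← lintegral_const_mul' _ _ ENNReal.coe_ne_top]
    have hfin := ae_lt_top' hFmeas (by rw [hFint]; exact hFfin)
    refine lintegral_mono_ae ?_
    filter_upwards [hfin] with x hx
    -- Almost every fibre of `F` is square summable, hence bounded.
    have hbdd : ∃ M, ∀ j : ℤ, ‖conj (F (x - T * j))‖ ≤ M := by
      refine ⟨√(∑' j : ℤ, ‖F (x - T * j)‖ₑ ^ 2).toReal, fun j => Real.le_sqrt_of_sq_le ?_⟩
      rw [RCLike.norm_conj]
      have h1 := ENNReal.toReal_mono hx.ne (ENNReal.le_tsum (f := fun j : ℤ =>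
        ‖F (x - T * j)‖ₑ ^ 2) j)
      rwa [ENNReal.toReal_pow, toReal_enorm] at h1
    have := hC (fun j => conj (F (x - T * j))) hbdd (-x)
    simp only [RCLike.enorm_conj] at this
    refine this.trans (le_of_eq ?_)
    simp only [enorm_tsum_translates_mul_conj]
  · rw [ENNReal.coe_mul, mul_assoc, ← hFint, ← lintegral_const_mul'' _ hFmeas]
    gcongr with x
    exact hupper x

end FrequencySide

/-! ### From extended-valued bounds to the frame property -/

section Frame

theorem isFrame_of_enorm_bounds {κ H : Type*} [NormedAddCommGroup H] [InnerProductSpace ℂ H]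
    {φ : κ → H} {C D : NNReal}
    (h : ∀ f : H, ‖f‖ₑ ^ 2 ≤ C * ∑' i, ‖inner ℂ f (φ i)‖ₑ ^ 2 ∧
      ∑' i, ‖inner ℂ f (φ i)‖ₑ ^ 2 ≤ D * ‖f‖ₑ ^ 2) : IsFrame φ := by
  -- Adding `1` keeps the lower frame bound positive even for `C = 0`.
  refine ⟨(C + 1 : ℝ)⁻¹, D, by positivity, fun f => ?_⟩
  obtain ⟨hl, hu⟩ := h f
  have hfin : ∑' i, ‖inner ℂ f (φ i)‖ₑ ^ 2 ≠ ⊤ :=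
    ne_top_of_le_ne_top (ENNReal.mul_ne_top ENNReal.coe_ne_top (by simp)) hu
  have hterm : ∀ i, (‖inner ℂ f (φ i)‖ₑ ^ 2).toReal = ‖inner ℂ f (φ i)‖ ^ 2 := fun i => by
    rw [ENNReal.toReal_pow, toReal_enorm]
  have hsum := ENNReal.summable_toReal hfin
  simp only [hterm] at hsum
  have htsum : (∑' i, ‖inner ℂ f (φ i)‖ₑ ^ 2).toReal = ∑' i, ‖inner ℂ f (φ i)‖ ^ 2 := by
    rw [ENNReal.tsum_toReal_eq fun i => by simp]
    simp only [hterm]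
  have hl' := ENNReal.toReal_mono (ENNReal.mul_ne_top ENNReal.coe_ne_top hfin) hl
  have hu' := ENNReal.toReal_mono (ENNReal.mul_ne_top ENNReal.coe_ne_top (by simp)) hu
  rw [ENNReal.toReal_mul, ENNReal.toReal_pow, toReal_enorm, htsum] at hl' hu'
  refine ⟨hsum, ?_, by simpa using hu'⟩
  rw [inv_mul_le_iff₀ (by positivity)]
  have h0 : 0 ≤ ∑' i, ‖inner ℂ f (φ i)‖ ^ 2 := tsum_nonneg fun i => by positivity
  simp only [ENNReal.coe_toReal] at hl'
  linarith

theorem lintegral_enorm_sq_fourier (f : Lp ℂ 2 (volume : Measure ℝ)) :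
    ∫⁻ ξ, ‖(𝓕 f : Lp ℂ 2 (volume : Measure ℝ)) ξ‖ₑ ^ 2 = ‖f‖ₑ ^ 2 := by
  have h1 : ‖f‖ₑ = ‖(𝓕 f : Lp ℂ 2 (volume : Measure ℝ))‖ₑ := by
    rw [← ofReal_norm, ← ofReal_norm, Lp.norm_fourier_eq]
  rw [h1, Lp.enorm_def]
  have := eLpNorm_nnreal_pow_eq_lintegral (p := 2) (μ := (volume : Measure ℝ))
    (f := (𝓕 f : Lp ℂ 2 (volume : Measure ℝ))) two_ne_zero
  simpa using this.symm

end Frame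

theorem theorem3 {N : ℕ} (a w : Fin N → ℂ)
    (hw : ∀ k, (w k).re < 0)
    (hne : ∀ j k, j ≠ k → (w j).re ≠ (w k).re)
    (hg : ∀ ξ : ℝ, 0 < ξ → fourierImproper (rationalWindow a w) ξ ≠ 0) :
    ∀ α β : ℝ, 0 < α → 0 < β → α * β < 1 → Irrational (α * β) →
      IsGaborFrame (rationalWindow a w) α β := by
  intro α β hα hβ hαβ hirr
  -- With these coefficients and exponents `expSum b z` equals the transform of the window on the
  -- positive half-line.
  let b : Fin N → ℂ := fun k => -(2 * Real.pi * Complex.I) * a k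
  let z : Fin N → ℂ := fun k => 2 * Real.pi * w k
  have hz : ∀ k, (z k).re < 0 := fun k => re_two_pi_mul (hw k)
  have hz' : Function.Injective fun k => (z k).re := by
    intro j k hjk
    by_contra hc
    apply hne j k hc
    have h2 : ∀ k, (z k).re = 2 * Real.pi * (w k).re := fun k => by simp [z]
    simp only [h2] at hjk
    exact mul_left_cancel₀ (by positivity) hjk
  have hH : ∀ τ : ℝ, 0 < τ → expSum b z τ ≠ 0 := by
    intro τ hτ
    have := hg τ hτ
    rw [fourierImproper_rationalWindow hw hτ] at this
    convert this using 1
    simp only [expSum, b, z, Finset.mul_sum, mul_assoc]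
  have hψ := integrable_causalExpSum b hz
  have hψ2 := memLp_causalExpSum b hz
  have hwin : 𝓕⁻ (causalExpSum b z) = rationalWindow a w := by
    ext t
    rw [fourierInv_causalExpSum b hz, rationalWindow]
    refine Finset.sum_congr rfl fun k _ => ?_
    have h1 := ofReal_sub_I_mul_ne_zero (hw k) t
    have hpi : (2 * Real.pi * Complex.I : ℂ) ≠ 0 := Complex.two_pi_I_ne_zero
    simp only [b, z]
    rw [two_pi_mul_add]
    field_simp
  have hmem : ∀ p : ℤ × ℤ, MemLp (gaborSystem (rationalWindow a w) α β p) 2 := fun p =>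
    memLp_timeFreqShift _ _ (memLp_rationalWindow a hw)
  refine ⟨hmem, ?_⟩
  have hβT : β < 1 / α := by
    rw [lt_div_iff₀ hα]
    linarith
  have hirr' : Irrational (β / (1 / α)) := by
    rwa [div_div_eq_mul_div, div_one, mul_comm]
  obtain ⟨C, D, hCD⟩ := exists_frequency_side_bounds (a := b) hz hz' hβ hβT hirr' hH
  refine isFrame_of_enorm_bounds (C := C) (D := D) fun f => ?_
  set F := (𝓕 f : Lp ℂ 2 (volume : Measure ℝ)) with hF
  have hsum : ∑' p : ℤ × ℤ,
      ‖inner ℂ f ((hmem p).toLp (gaborSystem (rationalWindow a w) α β p))‖ₑ ^ 2 =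
      ∑' (n : ℤ) (m : ℤ), ‖∫ ξ, F ξ * conj (causalExpSum b z (ξ + β * n)) *
        Complex.exp (2 * Real.pi * Complex.I * m * ξ / (1 / α : ℝ))‖ₑ ^ 2 := by
    -- The sum over `m` becomes the inner one, as Parseval requires, and `n` changes sign because a
    -- modulation by `β n` shifts the spectrum to `ξ - β n`.
    rw [ENNReal.tsum_prod', ENNReal.tsum_comm, ← (Equiv.neg ℤ).tsum_eq]
    refine tsum_congr fun n => tsum_congr fun m => ?_
    have h := hmem (m, Equiv.neg ℤ n)
    simp only [gaborSystem, ← hwin] at h ⊢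
    rw [enorm_inner_timeFreqShift hψ hψ2 f _ _ h]
    congr 2
    refine integral_congr_ae (ae_of_all _ fun ξ => ?_)
    simp only [Equiv.neg_apply]
    congr 1
    · congr 3
      push_cast
      ring
    · congr 1
      push_cast
      field_simp
  rw [hsum, ← lintegral_enorm_sq_fourier]
  exact hCD F (Lp.memLp F)
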